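/- Let $k$ be an infinite field and $S=k[x_0,\dots,x_r]$ with the standard grading. A homogeneous complete intersection of type $(e_1,\dots,e_c)$ is an ideal of $S$ generated by a regular sequence of forms of degrees $e_1,\dots,e_c$. We call $(d_1,\dots,d_c)$, $d_1\le\dots\le d_c$, the minimal possible type of a homogeneous complete intersection of height $c$ contained in an ideal $I$ if $I$ contains one of this type and every $(e_1,\dots,e_c)$, $e_1\le\dots\le e_c$, that is the type of one contained in $I$ satisfies $d_i\le e_i$ for all $i$. For ideals $L\subseteq I$ the residual of $I$ with respect to $L$ is $L:I$. Proper homogeneous ideals $I,J$ of height $c$ are directly homogeneously linked if $L:I=J$ and $L:J=I$ for some homogeneous complete intersection $L$ of height $c$; the direct link from $I$ to $J$ is minimal if $L$ has the minimal possible type among the homogeneous complete intersections of height $c$ contained in $I$. An ideal $I$ is homogeneously licci if a finite (possibly empty) sequence of direct homogeneous links leads from $I$ to a homogeneous complete intersection; it is minimally homogeneously licci if, moreover, such a sequence exists in which each link, from an ideal to the next one, is minimal. A form $F$ is regular modulo $I$ if it is a nonzerodivisor on $S/I$. **Proposition.** Let $c\ge 0$ and $(d_1,\dots,d_c)$ be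 given. There is an integer $D_0$ (depending only on $k$, $r$, $c$ and $d_1,\dots,d_c$) such that the following holds for every $D\ge D_0$. Let $\mathcal C$ be a class of proper homogeneous ideals of height $c$ in $S$ such that * $\mathcal C$ is closed under taking residuals with respect to homogeneous complete intersections of type $(d_1,\dots,d_c)$, i.e. $L:I\in\mathcal C$ whenever $I\in\mathcal C$ and $L\subseteq I$ is such a complete intersection; and * for every $I\in\mathcal C$, $(d_1,\dots,d_c)$ is the minimal possible type of a homogeneous complete intersection of height $c$ contained in $I$. Then: 1. If $I\in\mathcal C$ is homogeneously licci, then for a general form $F\in S$ of degree $D$ (that is, for all $F$ in some nonempty Zariski open subset of the space of forms of degree $D$), if $F$ is regular modulo $I$, then the ideal $(I,F)$ is homogeneously licci, but not minimally homogeneously licci. 2. Suppose in addition that $S/I'$ is Cohen–Macaulay for every $I'\in\mathcal C$. Let $\mathcal C'$ be the class of all ideals $(I',F')$ with $I'\in\mathcal C$ and $F'\in S$ a form of degree $D$ that is regular modulo $I'$. Then $\mathcal C'$ is closed under taking residuals with respect to homogeneous complete intersections of type $(d_1,\dots,d_c,D)$, and for every ideal in $\mathcal C'$, $(d_1,\dots,d_c,D)$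 is the minimal possible type of a homogeneous complete intersection of height $c+1$ contained in it. -/

import Mathlib

namespace HomLinkage

open MvPolynomial

/-- A commutative ring is Cohen-Macaulay if each localization at a maximal ideal has a regular
sequence whose length is its Krull dimension. (A regular sequence on a local ring generates a
proper ideal, so that it automatically lies in the maximal ideal.) -/
def IsCohenMacaulay (A : Type*) [CommRing A] : Prop :=
  ∀ (P : Ideal A) [P.IsMaximal], ∃ rs : List (Localization.AtPrime P),
    RingTheory.Sequence.IsRegular (Localization.AtPrime P) rs ∧
      (rs.length : WithBot ℕ∞) = ringKrullDim (Localization.AtPrime P)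

variable {k : Type*} [Field k] {n : ℕ}

/-- `I` is a homogeneous ideal of `k[x_1, …, x_n]` for the standard grading. -/
def IsHomogeneousIdeal (I : Ideal (MvPolynomial (Fin n) k)) : Prop :=
  letI : GradedAlgebra (homogeneousSubmodule (Fin n) k) := MvPolynomial.gradedAlgebra
  I.IsHomogeneous (homogeneousSubmodule (Fin n) k)

/-- `L` is a homogeneous complete intersection of type `(e_1, …, e_c)`: it is generated by a
regular sequence of forms of degrees `e_1, …, e_c`. -/
def IsCompleteIntersection {c : ℕ} (e : Fin c → ℕ) (L : Ideal (MvPolynomial (Fin n) k)) : Prop :=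
  ∃ f : Fin c → MvPolynomial (Fin n) k,
    (∀ i, (f i).IsHomogeneous (e i)) ∧
    RingTheory.Sequence.IsRegular (MvPolynomial (Fin n) k) (List.ofFn f) ∧
    L = Ideal.span (Set.range f)

/-- `(d_1, …, d_c)`, listed in nondecreasing order, is the minimal possible type of a homogeneous
complete intersection of height `c` contained in `I`: this type occurs, and it is componentwise
less than or equal to every type (listed in nondecreasing order) that occurs. -/
structure IsMinimalType {c : ℕ} (d : Fin c → ℕ) (I : Ideal (MvPolynomial (Fin n) k)) : Prop where
  monotone : Monotone d
  occurs : ∃ L, IsCompleteIntersection d L ∧ L ≤ I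
  le : ∀ e : Fin c → ℕ, Monotone e → (∃ L, IsCompleteIntersection e L ∧ L ≤ I) → ∀ i, d i ≤ e i

/-- `I` and `J` are proper homogeneous ideals of height `c` which are residual to each other with
respect to `L`, i.e. `L : I = J` and `L : J = I`. -/
structure AreLinkedBy (c : ℕ) (L I J : Ideal (MvPolynomial (Fin n) k)) : Prop where
  homogeneous_left : IsHomogeneousIdeal I
  homogeneous_right : IsHomogeneousIdeal J
  proper_left : I ≠ ⊤
  proper_right : J ≠ ⊤
  height_left : I.height = c
  height_right : J.height = c
  colon_left : Submodule.colon L (I : Set (MvPolynomial (Fin n) k)) = J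
  colon_right : Submodule.colon L (J : Set (MvPolynomial (Fin n) k)) = I

/-- Direct homogeneous linkage in height `c`. -/
def DirectlyLinked (c : ℕ) (I J : Ideal (MvPolynomial (Fin n) k)) : Prop :=
  ∃ (e : Fin c → ℕ) (L : Ideal (MvPolynomial (Fin n) k)),
    IsCompleteIntersection e L ∧ AreLinkedBy c L I J

/-- `I` is directly minimally homogeneously linked to `J`: the linking complete intersection has
the smallest possible type among those contained in `I`. This relation need not be symmetric. -/
def DirectlyMinimallyLinked (c : ℕ) (I J : Ideal (MvPolynomial (Fin n) k)) : Prop :=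
  ∃ (e : Fin c → ℕ) (L : Ideal (MvPolynomial (Fin n) k)),
    IsMinimalType e I ∧ IsCompleteIntersection e L ∧ AreLinkedBy c L I J

/-- `I` is homogeneously licci: finitely many (possibly no) direct homogeneous links lead from `I`
to a homogeneous complete intersection. -/
def IsHomogeneouslyLicci (I : Ideal (MvPolynomial (Fin n) k)) : Prop :=
  ∃ (c : ℕ) (K : Ideal (MvPolynomial (Fin n) k)),
    Relation.ReflTransGen (DirectlyLinked c) I K ∧
      ∃ e : Fin c → ℕ, IsCompleteIntersection e K

/-- `I` is minimally homogeneously licci: it is homogeneously licci, and finitely many (possibly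
no) direct minimal homogeneous links lead from `I` to a homogeneous complete intersection. -/
def IsMinimallyHomogeneouslyLicci (I : Ideal (MvPolynomial (Fin n) k)) : Prop :=
  IsHomogeneouslyLicci I ∧
  ∃ (c : ℕ) (K : Ideal (MvPolynomial (Fin n) k)),
    Relation.ReflTransGen (DirectlyMinimallyLinked c) I K ∧
      ∃ e : Fin c → ℕ, IsCompleteIntersection e K

/-- The class `C` is closed under taking residuals with respect to homogeneous complete
intersections of type `(d_1, …, d_c)`. -/
def ClosedUnderResiduals {c : ℕ} (d : Fin c → ℕ) (C : Set (Ideal (MvPolynomial (Fin n) k))) :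
    Prop :=
  ∀ I ∈ C, ∀ L : Ideal (MvPolynomial (Fin n) k), IsCompleteIntersection d L → L ≤ I →
    Submodule.colon L (I : Set (MvPolynomial (Fin n) k)) ∈ C

/-- `F` is regular modulo `I`, i.e. a nonzerodivisor on the quotient ring by `I`. -/
def IsRegularModulo (I : Ideal (MvPolynomial (Fin n) k)) (F : MvPolynomial (Fin n) k) : Prop :=
  IsSMulRegular (MvPolynomial (Fin n) k ⧸ I) F

/-- The ideals `(I', F')` with `I'` in `C` and `F'` a form of degree `D` regular modulo `I'`. -/
def hypersurfaceSections (D : ℕ) (C : Set (Ideal (MvPolynomial (Fin n) k))) :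
    Set (Ideal (MvPolynomial (Fin n) k)) :=
  {K | ∃ I ∈ C, ∃ F : MvPolynomial (Fin n) k,
    F.IsHomogeneous D ∧ IsRegularModulo I F ∧ K = I ⊔ Ideal.span {F}}

/-- `Q` holds for a general form of degree `D`, i.e. on a nonempty Zariski open subset of the
affine space of forms of degree `D`. It suffices to ask for a nonempty basic open subset, the set
of forms at whose coefficients a polynomial `P` does not vanish. -/
def HoldsForGeneralForm (D : ℕ) (Q : MvPolynomial (Fin n) k → Prop) : Prop :=
  ∃ P : MvPolynomial (Fin n →₀ ℕ) k,
    (∃ F : MvPolynomial (Fin n) k, F.IsHomogeneous D ∧ eval (fun m => coeff m F) P ≠ 0) ∧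
    ∀ F : MvPolynomial (Fin n) k, F.IsHomogeneous D → eval (fun m => coeff m F) P ≠ 0 → Q F

end HomLinkage

/-! Write `S` for the polynomial ring, `n` for its number of variables, and `C'` for the
hypersurface sections of members of the class. The obstruction to minimal linkage is that minimal
links never leave `C'`, while `C'` contains no complete intersection.

Minimal links stay in `C'` for reasons of degree. Since `D` exceeds every `d_i`, a complete
intersection of type `(d, D)` in `(I, F)` has its first `c` forms in `I`. By height, its last form
is `z = j + uF` with `j` in `I` and `u` a nonzero constant. Hence `(I, F) = (I, z)`, and with `L`
generated by the first `c` forms the residual is `(L, z) : (I, z) = (L : I, z)`, again in `C'`. A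
complete intersection in `C'` would have type `(d, D)`, because types of nested complete
intersections compare; its residual in itself, the unit ideal, would lie in `C'`, whose members are
proper. Conversely, cutting every link of a chain for `I` with one general `F` shows that `(I, F)`
is licci.

Two inputs are needed. First, residuals must commute with hypersurface sections
(`MultiplicationsOnly.colon_sup`). This is the vanishing of `Ext¹(S/J, S/L)` for `S/J` maximal
Cohen-Macaulay over the Gorenstein ring `S/L`. It is proved by cutting down with linear forms to an
Artinian ring with simple socle, which is self-injective, and lifting back with Nakayama's lemma.
Second, type `(d, D)` must occur in every `(I, F)`, although `F` need not be regular modulo any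
given `L ⊆ I` (`LinkageClass.exists_form_regMod`). By prime avoidance this holds once `D` exceeds a
bound on the generator degrees of `I` that depends only on `n` and `d`.

Both inputs rest on `LocalLike.exchange`: facts known modulo the variables pass to any regular
sequence of `n` forms of positive degree. Cohen-Macaulayness enters only through regular sequences
of `n - c` linear forms. Licci ideals have these automatically, so the first claim needs no such
hypothesis. -/

namespace HomLinkage

/-! ### Regular sequences, socles and the exchange principle. -/

section RegularSequences

variable {R : Type*} [CommRing R]

theorem mem_sup_span_singleton_iff {J : Ideal R} {x a : R} :
    a ∈ J ⊔ Ideal.span {x} ↔ ∃ j ∈ J, ∃ b, a = j + x * b := by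
  constructor
  · intro h
    obtain ⟨j, hj, y, hy, rfl⟩ := Submodule.mem_sup.1 h
    obtain ⟨b, rfl⟩ := Ideal.mem_span_singleton'.1 hy
    exact ⟨j, hj, b, by ring⟩
  · rintro ⟨j, hj, b, rfl⟩
    exact add_mem (Ideal.mem_sup_left hj)
      (Ideal.mem_sup_right (Ideal.mul_mem_right _ _ (Ideal.mem_span_singleton_self x)))

theorem self_mem_sup_span_singleton (J : Ideal R) (x : R) : x ∈ J ⊔ Ideal.span {x} :=
  Ideal.mem_sup_right (Ideal.mem_span_singleton_self x)

/-- `x` is a nonzerodivisor modulo the ideal `J`. -/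
def RegMod (J : Ideal R) (x : R) : Prop := ∀ a, x * a ∈ J → a ∈ J

/-- The list is a (weakly) regular sequence modulo the ideal `J`. -/
def RegSeq : Ideal R → List R → Prop
  | _, [] => True
  | J, x :: xs => RegMod J x ∧ RegSeq (J ⊔ Ideal.span {x}) xs

/-- The residue ring modulo `J` has a nonzero element killed by `𝔪`. -/
def HasSocle (𝔪 J : Ideal R) : Prop := ∃ u, u ∉ J ∧ ∀ z ∈ 𝔪, z * u ∈ J

/-- `P` is an associated prime of the residue ring modulo `J`. -/
def IsAss (J P : Ideal R) : Prop := P.IsPrime ∧ ∃ u, ∀ r, r ∈ P ↔ r * u ∈ J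

theorem RegMod.pow {J : Ideal R} {x : R} (h : RegMod J x) (t : ℕ) : RegMod J (x ^ t) := by
  induction t with
  | zero => intro a ha; simpa using ha
  | succ t ih => intro a ha; exact ih a (h _ (by rwa [pow_succ', mul_assoc] at ha))

theorem sup_ofList_cons (J : Ideal R) (x : R) (xs : List R) :
    J ⊔ Ideal.ofList (x :: xs) = J ⊔ Ideal.span {x} ⊔ Ideal.ofList xs := by
  rw [Ideal.ofList_cons, sup_assoc]

theorem sup_ofList_concat (J : Ideal R) (x : R) (xs : List R) :
    J ⊔ Ideal.ofList (xs ++ [x]) = J ⊔ Ideal.ofList xs ⊔ Ideal.span {x} := by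
  rw [Ideal.ofList_append, Ideal.ofList_singleton, sup_assoc]

theorem regSeq_append {J : Ideal R} {xs ys : List R} :
    RegSeq J (xs ++ ys) ↔ RegSeq J xs ∧ RegSeq (J ⊔ Ideal.ofList xs) ys := by
  induction xs generalizing J with
  | nil => simp [RegSeq]
  | cons x xs ih => rw [List.cons_append, RegSeq, RegSeq, ih, sup_ofList_cons, and_assoc]

theorem regSeq_concat {J : Ideal R} {xs : List R} {x : R} :
    RegSeq J (xs ++ [x]) ↔ RegSeq J xs ∧ RegMod (J ⊔ Ideal.ofList xs) x := by
  rw [regSeq_append]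
  simp [RegSeq]

theorem isAss_mem_associatedPrimes {J P : Ideal R} (h : IsAss J P) :
    P ∈ associatedPrimes R (R ⧸ J) := by
  obtain ⟨hP, u, hu⟩ := h
  refine ⟨hP, Ideal.Quotient.mk J u, ?_⟩
  have : P = Submodule.colon (⊥ : Submodule R (R ⧸ J)) {Ideal.Quotient.mk J u} := by
    ext r
    rw [hu, Submodule.mem_colon_singleton, Submodule.mem_bot, ← Ideal.Quotient.eq_zero_iff_mem,
      map_mul]
    rfl
  rw [← this, hP.radical]

theorem isAss_of_mem_associatedPrimes [IsNoetherianRing R] {J P : Ideal R}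
    (h : P ∈ associatedPrimes R (R ⧸ J)) : IsAss J P := by
  obtain ⟨hP, u, rfl⟩ := isAssociatedPrime_iff.1 h
  obtain ⟨u, rfl⟩ := Ideal.Quotient.mk_surjective u
  refine ⟨hP, u, fun r => ?_⟩
  rw [Submodule.mem_colon_singleton, Submodule.mem_bot, ← Ideal.Quotient.eq_zero_iff_mem,
      map_mul]
  rfl

theorem finite_isAss [IsNoetherianRing R] (J : Ideal R) : {P | IsAss J P}.Finite :=
  (associatedPrimes.finite R (R ⧸ J)).subset fun _ h => isAss_mem_associatedPrimes h

theorem exists_isAss_of_notMem [IsNoetherianRing R] {J : Ideal R} {u : R} (hu : u ∉ J) :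
    ∃ P, IsAss J P ∧ ∀ r, r * u ∈ J → r ∈ P := by
  obtain ⟨P, hP, h⟩ := exists_le_isAssociatedPrime_of_isNoetherianRing R (Ideal.Quotient.mk J u)
    (by rwa [Ne, Ideal.Quotient.eq_zero_iff_mem])
  refine ⟨P, isAss_of_mem_associatedPrimes hP, fun r hr => h ?_⟩
  rw [Submodule.mem_colon_singleton, Submodule.mem_bot]
  rw [← Ideal.Quotient.eq_zero_iff_mem, map_mul] at hr
  exact hr

theorem regMod_of_notMem_isAss [IsNoetherianRing R] {J : Ideal R} {x : R}
    (h : ∀ P, IsAss J P → x ∉ P) : RegMod J x := by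
  intro a ha
  by_contra haJ
  obtain ⟨P, hP, hPa⟩ := exists_isAss_of_notMem haJ
  exact h P hP (hPa x ha)

theorem IsAss.le {J P : Ideal R} (h : IsAss J P) : J ≤ P := by
  obtain ⟨_, u, hu⟩ := h
  exact fun r hr => (hu r).2 (J.mul_mem_right u hr)

theorem IsAss.exists_notMem {J P : Ideal R} (h : IsAss J P) :
    ∃ u, u ∉ J ∧ ∀ r, r ∈ P ↔ r * u ∈ J := by
  obtain ⟨hP, u, hu⟩ := h
  exact ⟨u, fun h => hP.ne_top ((Ideal.eq_top_iff_one _).2 ((hu 1).2 (by simpa using h))), hu⟩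

theorem IsAss.notMem_of_regMod {J P : Ideal R} (h : IsAss J P) {x : R} (hx : RegMod J x) :
    x ∉ P := by
  obtain ⟨u, hu, hP⟩ := h.exists_notMem
  exact fun hxP => hu (hx u ((hP x).1 hxP))

theorem IsAss.not_le_of_not_hasSocle {𝔪 J P : Ideal R} (h : IsAss J P) (hs : ¬ HasSocle 𝔪 J) :
    ¬ 𝔪 ≤ P := by
  obtain ⟨u, hu, hP⟩ := h.exists_notMem
  exact fun hle => hs ⟨u, hu, fun z hz => (hP z).1 (hle hz)⟩

theorem RegMod.not_hasSocle {𝔪 J : Ideal R} {x : R} (h : RegMod J x) (hx : x ∈ 𝔪) :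
    ¬ HasSocle 𝔪 J := by
  rintro ⟨u, hu, hz⟩
  exact hu (h u (hz x hx))

/-- Elements of `Z` avoid finitely many primes, as long as none of these contains `𝔪`. -/
def Avoids (𝔪 : Ideal R) (Z : Set R) : Prop :=
  ∀ s : Set (Ideal R), s.Finite → (∀ P ∈ s, P.IsPrime ∧ ¬ 𝔪 ≤ P) → ∃ z ∈ Z, ∀ P ∈ s, z ∉ P

/-- An associated prime containing `𝔪` would produce a socle element, so `Z` can avoid all
associated primes. Two ideals are treated at once because the exchange argument needs one element
that serves both. -/
theorem Avoids.exists_regMod [IsNoetherianRing R] {𝔪 : Ideal R} {Z : Set R} (hZ : Avoids 𝔪 Z)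
    {J J' : Ideal R} (hJ : ¬ HasSocle 𝔪 J) (hJ' : ¬ HasSocle 𝔪 J') :
    ∃ z ∈ Z, RegMod J z ∧ RegMod J' z := by
  obtain ⟨z, hz, h⟩ := hZ ({P | IsAss J P} ∪ {P | IsAss J' P})
    ((finite_isAss J).union (finite_isAss J')) (by
      rintro P (hP | hP)
      · exact ⟨hP.1, IsAss.not_le_of_not_hasSocle hP hJ⟩
      · exact ⟨hP.1, IsAss.not_le_of_not_hasSocle hP hJ'⟩)
  exact ⟨z, hz, regMod_of_notMem_isAss fun P hP => h P (.inl hP),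
    regMod_of_notMem_isAss fun P hP => h P (.inr hP)⟩

/-- A family of ideals and a set of elements of `𝔪` for which sequences that are regular modulo
an ideal of the family behave as over a local ring. -/
structure LocalLike (𝔪 : Ideal R) (𝒥 : Set (Ideal R)) (X : Set R) : Prop where
  closed : ∀ J ∈ 𝒥, ∀ r ∉ 𝔪, RegMod J r
  sup_mem : ∀ J ∈ 𝒥, ∀ x ∈ X, J ⊔ Ideal.span {x} ∈ 𝒥
  subset : ∀ x ∈ X, x ∈ 𝔪

namespace LocalLike

variable {𝔪 : Ideal R} {𝒥 : Set (Ideal R)} {X : Set R}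

theorem mono {Y : Set R} (h : LocalLike 𝔪 𝒥 X) (hY : Y ⊆ X) : LocalLike 𝔪 𝒥 Y :=
  ⟨h.closed, fun J hJ x hx => h.sup_mem J hJ x (hY hx), fun x hx => h.subset x (hY hx)⟩

theorem sup_ofList_mem (h : LocalLike 𝔪 𝒥 X) {J : Ideal R} (hJ : J ∈ 𝒥) {xs : List R}
    (hxs : ∀ x ∈ xs, x ∈ X) : J ⊔ Ideal.ofList xs ∈ 𝒥 := by
  induction xs generalizing J with
  | nil => simpa using hJ
  | cons x xs ih =>
    rw [sup_ofList_cons]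
    exact ih (h.sup_mem J hJ x (hxs x (by simp))) fun y hy => hxs y (by simp [hy])

/-- Nakayama's lemma. -/
theorem le_of_le_sup_mul [IsNoetherianRing R] [𝔪.IsMaximal] (h : LocalLike 𝔪 𝒥 X) {J N : Ideal R}
    (hJ : J ∈ 𝒥) {x : R} (hx : x ∈ 𝔪) (hN : ∀ a ∈ N, ∃ j ∈ J, ∃ b ∈ N, a = j + x * b) :
    N ≤ J := by
  -- The determinant trick gives `r ≡ 1` modulo `𝔪` with `r N ⊆ J`. Such an `r` is outside `𝔪`,
  -- hence can be cancelled modulo `J`.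
  obtain ⟨r, hr, hle⟩ := Submodule.exists_sub_one_mem_and_smul_le_of_fg_of_le_sup (I := 𝔪)
    (N := J) (N' := N) (P := N) (IsNoetherian.noetherian N) le_rfl (by
      intro a ha
      obtain ⟨j, hj, b, hb, rfl⟩ := hN a ha
      exact add_mem (Submodule.mem_sup_left hj)
        (Submodule.mem_sup_right (Submodule.smul_mem_smul hx hb)))
  intro a ha
  refine h.closed J hJ r (fun hrm => ?_) a (hle (Submodule.smul_mem_pointwise_smul a r N ha))
  have := 𝔪.sub_mem hrm hr
  rw [sub_sub_cancel] at this
  exact (Ideal.ne_top_iff_one 𝔪).1 (Ideal.IsMaximal.ne_top inferInstance) this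

/-- For `N = (J : y)` the hypotheses give `N ⊆ J + xN`, so Nakayama makes `y` regular modulo `J`.
The second half is a direct cancellation of `x`. -/
theorem swap [IsNoetherianRing R] [𝔪.IsMaximal] (h : LocalLike 𝔪 𝒥 X) {J : Ideal R}
    (hJ : J ∈ 𝒥) {x y : R} (hx : x ∈ 𝔪) (hxJ : RegMod J x)
    (hy : RegMod (J ⊔ Ideal.span {x}) y) : RegMod J y ∧ RegMod (J ⊔ Ideal.span {y}) x := by
  have hyJ : RegMod J y := by
    have : Submodule.comap (LinearMap.mulLeft R y) J ≤ J := by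
      refine h.le_of_le_sup_mul hJ hx fun a ha => ?_
      replace ha : y * a ∈ J := ha
      obtain ⟨j, hj, b, rfl⟩ := mem_sup_span_singleton_iff.1 (hy a (Ideal.mem_sup_left ha))
      refine ⟨j, hj, b, hxJ _ ?_, rfl⟩
      have := J.sub_mem ha (J.mul_mem_left y hj)
      convert this using 1
      simp only [LinearMap.mulLeft_apply]
      ring
    exact fun a ha => this ha
  refine ⟨hyJ, fun a ha => ?_⟩
  obtain ⟨j, hj, b, hb⟩ := mem_sup_span_singleton_iff.1 ha
  have : y * b ∈ J ⊔ Ideal.span {x} :=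
    mem_sup_span_singleton_iff.2 ⟨-j, J.neg_mem hj, a, by rw [hb]; ring⟩
  obtain ⟨j', hj', b', rfl⟩ := mem_sup_span_singleton_iff.1 (hy b this)
  refine mem_sup_span_singleton_iff.2 ⟨a - y * b', hxJ _ ?_, b', by ring⟩
  have := J.add_mem hj (J.mul_mem_left y hj')
  convert this using 1
  rw [mul_sub, hb]
  ring

theorem regSeq_cons_of_concat [IsNoetherianRing R] [𝔪.IsMaximal] (h : LocalLike 𝔪 𝒥 X)
    {J : Ideal R} (hJ : J ∈ 𝒥) {xs : List R} (hxs : ∀ x ∈ xs, x ∈ X) {z : R}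
    (hz : RegSeq J (xs ++ [z])) : RegSeq J (z :: xs) := by
  induction xs generalizing J with
  | nil => exact hz
  | cons x xs ih =>
    obtain ⟨hx, hz⟩ := hz
    obtain ⟨hz, hxs'⟩ := ih (h.sup_mem J hJ x (hxs x (by simp))) (fun y hy => hxs y (by simp [hy])) hz
    obtain ⟨h1, h2⟩ := h.swap hJ (h.subset x (hxs x (by simp))) hx hz
    refine ⟨h1, h2, ?_⟩
    rwa [sup_right_comm]

theorem regSeq_perm [IsNoetherianRing R] [𝔪.IsMaximal] (h : LocalLike 𝔪 𝒥 X)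
    {J : Ideal R} (hJ : J ∈ 𝒥) {xs ys : List R} (hp : xs.Perm ys) (hxs : ∀ x ∈ xs, x ∈ X)
    (hreg : RegSeq J xs) : RegSeq J ys := by
  induction hp generalizing J with
  | nil => exact hreg
  | cons x _ ih =>
    exact ⟨hreg.1, ih (h.sup_mem J hJ x (hxs x (by simp))) (fun y hy => hxs y (by simp [hy])) hreg.2⟩
  | swap x y l =>
    obtain ⟨h1, h2, h3⟩ := hreg
    obtain ⟨h4, h5⟩ := h.swap hJ (h.subset y (hxs y (by simp))) h1 h2
    refine ⟨h4, h5, ?_⟩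
    rwa [sup_right_comm]
  | trans h₁ _ ih₁ ih₂ =>
    exact ih₂ hJ (fun x hx => hxs x (h₁.symm.subset hx)) (ih₁ hJ hxs hreg)

/-- The exchange principle: a property of ideals that is preserved when the last element of a
regular sequence is exchanged is preserved when all elements are exchanged. -/
theorem exchange [IsNoetherianRing R] [𝔪.IsMaximal] (h : LocalLike 𝔪 𝒥 X) {Z : Set R}
    (hZX : Z ⊆ X) (hZ : Avoids 𝔪 Z) {T : ℕ → Ideal R → Prop} {E : ℕ}
    (hT : ∀ s, ∀ J ∈ 𝒥, ∀ y ∈ Z, ∀ x ∈ X, RegMod J y → RegMod J x →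
      T s (J ⊔ Ideal.span {y}) → T (s + E) (J ⊔ Ideal.span {x}))
    {m : ℕ} {J : Ideal R} (hJ : J ∈ 𝒥) {xs ys : List R} (hxs : ∀ x ∈ xs, x ∈ X)
    (hys : ∀ y ∈ ys, y ∈ Z) (hxm : xs.length = m) (hym : ys.length = m) (hx : RegSeq J xs)
    (hy : RegSeq J ys) {s : ℕ} (hs : T s (J ⊔ Ideal.ofList ys)) :
    T (s + m * (2 * E)) (J ⊔ Ideal.ofList xs) := by
  induction m generalizing J xs ys s with
  | zero =>
    obtain rfl := List.length_eq_zero_iff.1 hxm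
    obtain rfl := List.length_eq_zero_iff.1 hym
    simpa using hs
  | succ m ih =>
    rcases List.eq_nil_or_concat' xs with rfl | ⟨xs, x, rfl⟩
    · simp at hxm
    rcases List.eq_nil_or_concat' ys with rfl | ⟨ys, y, rfl⟩
    · simp at hym
    obtain ⟨hx, hxx⟩ := regSeq_concat.1 hx
    obtain ⟨hy, hyy⟩ := regSeq_concat.1 hy
    have hxX : x ∈ X := hxs x (by simp)
    have hyZ : y ∈ Z := hys y (by simp)
    replace hxs : ∀ x ∈ xs, x ∈ X := fun x hx => hxs x (by simp [hx])
    replace hys : ∀ y ∈ ys, y ∈ Z := fun y hy => hys y (by simp [hy])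
    -- The element `z` mediates: exchange `y` for `z`, move `z` to the front, exchange the remaining
    -- elements modulo `J + (z)` by induction, then exchange `z` for `x`. The two exchanges
    -- involving `z` account for the `2 * E`.
    obtain ⟨z, hzZ, hzx, hzy⟩ := hZ.exists_regMod (hxx.not_hasSocle (h.subset x hxX))
      (hyy.not_hasSocle (h.subset y (hZX hyZ)))
    have h1 := h.regSeq_cons_of_concat hJ hxs (regSeq_concat.2 ⟨hx, hzx⟩)
    have h2 := h.regSeq_cons_of_concat hJ (fun y hy => hZX (hys y hy))
      (regSeq_concat.2 ⟨hy, hzy⟩)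
    rw [sup_ofList_concat] at hs ⊢
    have h3 := hT s _ (h.sup_ofList_mem hJ fun y hy => hZX (hys y hy)) y hyZ z (hZX hzZ) hyy hzy hs
    rw [sup_right_comm] at h3
    have h4 := ih (h.sup_mem J hJ z (hZX hzZ)) hxs hys (by simpa using hxm) (by simpa using hym)
      h1.2 h2.2 h3
    rw [sup_right_comm] at h4
    have h5 := hT _ _ (h.sup_ofList_mem hJ hxs) z hzZ x hxX hzx hxx h4
    convert h5 using 1
    ring

/-- The socle element `w` goes to the `w'` with `y w ≡ x w'` modulo `J`. When `x` also lies in `𝔪`,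
both socles are `Ext¹(R/𝔪, R/J)`. -/
theorem hasSocle_exchange {J : Ideal R} {x y : R} (hy : y ∈ 𝔪)
    (hxJ : RegMod J x) (hyJ : RegMod J y) (hs : HasSocle 𝔪 (J ⊔ Ideal.span {x})) :
    HasSocle 𝔪 (J ⊔ Ideal.span {y}) := by
  obtain ⟨w, hw, hz⟩ := hs
  obtain ⟨j, hj, w', hw'⟩ := mem_sup_span_singleton_iff.1 (hz y hy)
  refine ⟨w', fun hmem => hw ?_, fun z hz' => ?_⟩
  · obtain ⟨j', hj', b, rfl⟩ := mem_sup_span_singleton_iff.1 hmem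
    refine mem_sup_span_singleton_iff.2 ⟨w - x * b, hyJ _ ?_, b, by ring⟩
    convert J.add_mem hj (J.mul_mem_left x hj') using 1
    rw [mul_sub, hw']
    ring
  · obtain ⟨j', hj', b, hb⟩ := mem_sup_span_singleton_iff.1 (hz z hz')
    refine mem_sup_span_singleton_iff.2 ⟨z * w' - y * b, hxJ _ ?_, b, by ring⟩
    convert J.sub_mem (J.mul_mem_left y hj') (J.mul_mem_left z hj) using 1
    have h1 : z * (x * w') = z * (y * w) - z * j := by rw [hw']; ring
    have h2 : z * (y * w) = y * (j' + x * b) := by rw [← hb]; ring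
    linear_combination h1 + h2

/-- A regular sequence that is shorter than another one can be extended. -/
theorem not_hasSocle_of_length_lt [IsNoetherianRing R] [𝔪.IsMaximal] (h : LocalLike 𝔪 𝒥 X)
    (hX : Avoids 𝔪 X) {J : Ideal R} (hJ : J ∈ 𝒥) {xs ys : List R} (hxs : ∀ x ∈ xs, x ∈ X)
    (hys : ∀ y ∈ ys, y ∈ X) (hlt : xs.length < ys.length) (hx : RegSeq J xs)
    (hy : RegSeq J ys) : ¬ HasSocle 𝔪 (J ⊔ Ideal.ofList xs) := by
  intro hs
  obtain ⟨l, y, l', rfl, hl⟩ : ∃ l y l', ys = l ++ y :: l' ∧ l.length = xs.length := by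
    refine ⟨ys.take xs.length, ys[xs.length], ys.drop (xs.length + 1), ?_, ?_⟩
    · simp
    · simp [hlt.le]
  obtain ⟨hl1, hl2, -⟩ := regSeq_append.1 hy
  -- The socle moves from `xs` to the prefix `l` of `ys`, where the next element `y` is regular and
  -- forbids it.
  have := h.exchange (T := fun _ J => HasSocle 𝔪 J) (E := 0) subset_rfl hX
    (fun _ J hJ y hy x hx hyJ hxJ hs =>
      hasSocle_exchange (h.subset x hx) hyJ hxJ hs)
    hJ (xs := l) (ys := xs) (fun x hx => hys x (by simp [hx])) hxs hl rfl hl1 hx (s := 0) hs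
  exact hl2.not_hasSocle (h.subset y (hys y (by simp))) this

theorem exists_regSeq_extension [IsNoetherianRing R] [𝔪.IsMaximal] (h : LocalLike 𝔪 𝒥 X)
    (hX : Avoids 𝔪 X) {Z : Set R} (hZX : Z ⊆ X) (hZ : Avoids 𝔪 Z)
    {J : Ideal R} (hJ : J ∈ 𝒥) {xs ys : List R} (hxs : ∀ x ∈ xs, x ∈ X)
    (hys : ∀ y ∈ ys, y ∈ X) (hle : xs.length ≤ ys.length) (hx : RegSeq J xs)
    (hy : RegSeq J ys) :
    ∃ zs : List R, (∀ z ∈ zs, z ∈ Z) ∧ xs.length + zs.length = ys.length ∧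
      RegSeq J (xs ++ zs) := by
  obtain ⟨t, ht⟩ := Nat.exists_eq_add_of_le hle
  induction t generalizing xs with
  | zero => exact ⟨[], by simp, by simp [ht], by simpa using hx⟩
  | succ t ih =>
    have hs := h.not_hasSocle_of_length_lt hX hJ hxs hys (by omega) hx hy
    obtain ⟨z, hz, hzr, -⟩ := hZ.exists_regMod hs hs
    obtain ⟨zs, h1, h2, h3⟩ := ih (xs := xs ++ [z])
      (by simpa [or_imp, forall_and] using ⟨hxs, hZX hz⟩) (by simp; omega)
      (regSeq_concat.2 ⟨hx, hzr⟩) (by simp; omega)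
    refine ⟨z :: zs, by simpa using ⟨hz, h1⟩, by simp at h2 ⊢; omega, by simpa using h3⟩

/-- Two ideals with regular sequences of the same length have a common one. -/
theorem exists_common_regSeq [IsNoetherianRing R] [𝔪.IsMaximal] (h : LocalLike 𝔪 𝒥 X)
    (hX : Avoids 𝔪 X) {Z : Set R} (hZX : Z ⊆ X) (hZ : Avoids 𝔪 Z)
    {J J' : Ideal R} (hJ : J ∈ 𝒥) (hJ' : J' ∈ 𝒥) {ys ys' : List R} (hys : ∀ y ∈ ys, y ∈ X)
    (hys' : ∀ y ∈ ys', y ∈ X) (hlen : ys.length = ys'.length)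
    (hy : RegSeq J ys) (hy' : RegSeq J' ys') :
    ∃ zs : List R, (∀ z ∈ zs, z ∈ Z) ∧ zs.length = ys.length ∧ RegSeq J zs ∧ RegSeq J' zs := by
  suffices ∀ t ≤ ys.length, ∃ zs : List R, (∀ z ∈ zs, z ∈ Z) ∧ zs.length = t ∧
      RegSeq J zs ∧ RegSeq J' zs from this _ le_rfl
  intro t ht
  induction t with
  | zero => exact ⟨[], by simp, rfl, trivial, trivial⟩
  | succ t ih =>
    obtain ⟨zs, h1, h2, h3, h4⟩ := ih (by omega)
    obtain ⟨z, hz, hzr, hzr'⟩ := hZ.exists_regMod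
      (h.not_hasSocle_of_length_lt hX hJ (fun z hz => hZX (h1 z hz)) hys (by omega) h3 hy)
      (h.not_hasSocle_of_length_lt hX hJ' (fun z hz => hZX (h1 z hz)) hys' (by omega) h4 hy')
    exact ⟨zs ++ [z], by simpa [or_imp, forall_and] using ⟨h1, hz⟩, by simp [h2],
      regSeq_concat.2 ⟨h3, hzr⟩, regSeq_concat.2 ⟨h4, hzr'⟩⟩

/-- Associated primes ascend along a regular sequence. -/
theorem height_like_add_length_le [IsNoetherianRing R] [𝔪.IsMaximal] (h : LocalLike 𝔪 𝒥 X)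
    (f : Ideal R → ℕ∞) {I : Ideal R}
    (hf : ∀ P Q : Ideal R, P.IsPrime → Q.IsPrime → I ≤ P → P < Q → f P + 1 ≤ f Q)
    {J : Ideal R} (hJ : J ∈ 𝒥) {xs : List R} (hxs : ∀ x ∈ xs, x ∈ X) (hx : RegSeq J xs)
    {P : Ideal R} (hP : IsAss J P) (hIP : I ≤ P) : f P + xs.length ≤ f 𝔪 := by
  induction xs generalizing J P with
  | nil =>
    obtain ⟨u, hu, hPu⟩ := hP.exists_notMem
    have hle : P ≤ 𝔪 := by
      intro r hr
      by_contra hrm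
      exact hu (h.closed J hJ r hrm u ((hPu r).1 hr))
    simp only [List.length_nil, Nat.cast_zero, add_zero]
    rcases hle.eq_or_lt with rfl | hlt
    · exact le_rfl
    · exact le_self_add.trans (hf P 𝔪 hP.1 (Ideal.IsMaximal.isPrime inferInstance) hIP hlt)
  | cons x xs ih =>
    have hxX := hxs x (by simp)
    have hxm := h.subset x hxX
    obtain ⟨u, hu, hPu⟩ := hP.exists_notMem
    -- Otherwise `(J : P) ⊆ J + x (J : P)`, so Nakayama gives `(J : P) ⊆ J`, which contradicts that
    -- `P` is associated. An associated prime of `J + (x)` over the annihilator of `v` then contains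
    -- both `P` and `x`.
    have hex : ∃ v, (∀ r ∈ P, r * v ∈ J) ∧ v ∉ J ⊔ Ideal.span {x} := by
      by_contra! hcon
      have : Submodule.colon J (P : Set R) ≤ J := by
        refine h.le_of_le_sup_mul hJ hxm fun a ha => ?_
        rw [Submodule.mem_colon] at ha
        obtain ⟨j, hj, b, rfl⟩ := mem_sup_span_singleton_iff.1
          (hcon a fun r hr => by simpa [mul_comm] using ha r hr)
        refine ⟨j, hj, b, ?_, rfl⟩
        rw [Submodule.mem_colon]
        intro r hr
        refine hx.1 _ ?_
        have := J.sub_mem (ha r hr) (J.mul_mem_left r hj)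
        convert this using 1
        simp only [smul_eq_mul]
        ring
      refine hu (this ?_)
      rw [Submodule.mem_colon]
      intro r hr
      simpa [mul_comm] using (hPu r).1 hr
    obtain ⟨v, hPv, hv⟩ := hex
    obtain ⟨Q, hQ, hQv⟩ := exists_isAss_of_notMem hv
    have hxQ : x ∈ Q := hQ.le (self_mem_sup_span_singleton J x)
    have hPQ : P < Q := by
      refine lt_of_le_of_ne (fun r hr => hQv r (Ideal.mem_sup_left (hPv r hr))) ?_
      rintro rfl
      exact hP.notMem_of_regMod hx.1 hxQ
    have h1 := ih (h.sup_mem J hJ x hxX) (fun y hy => hxs y (by simp [hy])) hx.2 hQ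
      (hIP.trans hPQ.le)
    have h2 := hf P Q hP.1 hQ.1 hIP hPQ
    calc f P + (x :: xs).length = f P + 1 + xs.length := by
          push_cast [List.length_cons]; ring
      _ ≤ f Q + xs.length := by gcongr
      _ ≤ _ := h1

end LocalLike

end RegularSequences

end HomLinkage

namespace HomLinkage

/-! ### Homogeneous ideals behave as over a local ring. -/

section Graded

open MvPolynomial

variable {k : Type*} [Field k] {n : ℕ}

theorem isHomogeneousIdeal_iff {I : Ideal (MvPolynomial (Fin n) k)} :
    IsHomogeneousIdeal I ↔ ∀ f ∈ I, ∀ t, homogeneousComponent t f ∈ I := by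
  let _ : GradedAlgebra (homogeneousSubmodule (Fin n) k) := MvPolynomial.gradedAlgebra
  constructor
  · intro h f hf t
    exact homogeneousComponent_mem_of_mem h hf t
  · intro h
    change I.IsHomogeneous (homogeneousSubmodule (Fin n) k)
    intro t f hf
    have := h f hf t
    rwa [← MvPolynomial.decomposition.decompose'_apply] at this

theorem homogeneousComponent_add_mul {x : MvPolynomial (Fin n) k} {e : ℕ}
    (hx : x.IsHomogeneous e) (t : ℕ) (b : MvPolynomial (Fin n) k) :
    homogeneousComponent (e + t) (x * b) = x * homogeneousComponent t b := by
  conv_lhs => rw [← sum_homogeneousComponent b, Finset.mul_sum, map_sum]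
  conv_rhs => rw [← sum_homogeneousComponent b, map_sum, Finset.mul_sum]
  refine Finset.sum_congr rfl fun i _ => ?_
  rw [homogeneousComponent_of_mem (hx.mul (homogeneousComponent_isHomogeneous i b)),
    homogeneousComponent_of_mem (homogeneousComponent_isHomogeneous i b)]
  simp [mul_ite]

theorem homogeneousComponent_mul_of_lt {x : MvPolynomial (Fin n) k} {e : ℕ}
    (hx : x.IsHomogeneous e) {t : ℕ} (ht : t < e) (b : MvPolynomial (Fin n) k) :
    homogeneousComponent t (x * b) = 0 := by
  rw [← sum_homogeneousComponent b, Finset.mul_sum, map_sum]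
  refine Finset.sum_eq_zero fun i _ => ?_
  rw [homogeneousComponent_of_mem (hx.mul (homogeneousComponent_isHomogeneous i b)),
    if_neg (by omega)]

theorem mem_of_homogeneousComponent_mem {I : Ideal (MvPolynomial (Fin n) k)}
    {f : MvPolynomial (Fin n) k} (h : ∀ t, homogeneousComponent t f ∈ I) : f ∈ I := by
  rw [← sum_homogeneousComponent f]
  exact sum_mem fun t _ => h t

theorem IsHomogeneousIdeal.sup_span_singleton {I : Ideal (MvPolynomial (Fin n) k)}
    (hI : IsHomogeneousIdeal I) {x : MvPolynomial (Fin n) k} {e : ℕ} (hx : x.IsHomogeneous e) :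
    IsHomogeneousIdeal (I ⊔ Ideal.span {x}) := by
  rw [isHomogeneousIdeal_iff] at hI ⊢
  intro f hf t
  obtain ⟨j, hj, b, rfl⟩ := mem_sup_span_singleton_iff.1 hf
  rw [map_add]
  refine add_mem (Ideal.mem_sup_left (hI j hj t)) (Ideal.mem_sup_right ?_)
  rcases lt_or_ge t e with ht | ht
  · rw [homogeneousComponent_mul_of_lt hx ht]
    exact zero_mem _
  · obtain ⟨t, rfl⟩ := Nat.exists_eq_add_of_le ht
    rw [homogeneousComponent_add_mul hx]
    exact Ideal.mul_mem_right _ _ (Ideal.mem_span_singleton_self x)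

theorem IsHomogeneousIdeal.exists_decomposition {I : Ideal (MvPolynomial (Fin n) k)}
    (hI : IsHomogeneousIdeal I) {x f : MvPolynomial (Fin n) k} {e t : ℕ}
    (hx : x.IsHomogeneous e) (hf : f.IsHomogeneous (e + t)) (hfI : f ∈ I ⊔ Ideal.span {x}) :
    ∃ j ∈ I, j.IsHomogeneous (e + t) ∧ ∃ b, b.IsHomogeneous t ∧ f = j + x * b := by
  rw [isHomogeneousIdeal_iff] at hI
  obtain ⟨j, hj, b, rfl⟩ := mem_sup_span_singleton_iff.1 hfI
  refine ⟨homogeneousComponent (e + t) j, hI j hj _, homogeneousComponent_isHomogeneous _ _,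
    homogeneousComponent t b, homogeneousComponent_isHomogeneous _ _, ?_⟩
  rw [← homogeneousComponent_add_mul hx, ← map_add, homogeneousComponent_eq_self hf]

theorem IsHomogeneousIdeal.mem_of_lt {I : Ideal (MvPolynomial (Fin n) k)}
    (hI : IsHomogeneousIdeal I) {x f : MvPolynomial (Fin n) k} {e t : ℕ}
    (hx : x.IsHomogeneous e) (hf : f.IsHomogeneous t) (ht : t < e)
    (hfI : f ∈ I ⊔ Ideal.span {x}) : f ∈ I := by
  rw [isHomogeneousIdeal_iff] at hI
  obtain ⟨j, hj, b, rfl⟩ := mem_sup_span_singleton_iff.1 hfI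
  rw [← homogeneousComponent_eq_self hf, map_add, homogeneousComponent_mul_of_lt hx ht, add_zero]
  exact hI j hj t

theorem isHomogeneousIdeal_bot : IsHomogeneousIdeal (⊥ : Ideal (MvPolynomial (Fin n) k)) := by
  rw [isHomogeneousIdeal_iff]
  intro f hf t
  rw [Ideal.mem_bot] at hf ⊢
  rw [hf, map_zero]

theorem isHomogeneousIdeal_ofList {xs : List (MvPolynomial (Fin n) k)}
    (hxs : ∀ x ∈ xs, ∃ e, x.IsHomogeneous e) {J : Ideal (MvPolynomial (Fin n) k)}
    (hJ : IsHomogeneousIdeal J) : IsHomogeneousIdeal (J ⊔ Ideal.ofList xs) := by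
  induction xs generalizing J with
  | nil => simpa using hJ
  | cons x xs ih =>
    rw [sup_ofList_cons]
    obtain ⟨e, he⟩ := hxs x (by simp)
    exact ih (fun y hy => hxs y (by simp [hy])) (hJ.sup_span_singleton he)

theorem isHomogeneousIdeal_colon {L I : Ideal (MvPolynomial (Fin n) k)}
    (hL : IsHomogeneousIdeal L) (hI : IsHomogeneousIdeal I) :
    IsHomogeneousIdeal (Submodule.colon L (I : Set (MvPolynomial (Fin n) k))) := by
  rw [isHomogeneousIdeal_iff] at hL hI ⊢
  intro f hf t
  rw [Submodule.mem_colon] at hf ⊢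
  intro g hg
  rw [← sum_homogeneousComponent g, Finset.smul_sum]
  refine sum_mem fun i _ => ?_
  have := hL _ (hf _ (hI g hg i)) (i + t)
  rwa [smul_eq_mul, mul_comm, homogeneousComponent_add_mul
    (homogeneousComponent_isHomogeneous i g), mul_comm] at this

variable (k n) in
/-- The ideal generated by the variables. -/
noncomputable def irrelevant : Ideal (MvPolynomial (Fin n) k) := RingHom.ker constantCoeff

instance : (irrelevant k n).IsMaximal :=
  RingHom.ker_isMaximal_of_surjective constantCoeff fun a => ⟨C a, by simp⟩

theorem mem_irrelevant {f : MvPolynomial (Fin n) k} :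
    f ∈ irrelevant k n ↔ constantCoeff f = 0 := Iff.rfl

theorem mem_irrelevant_of_isHomogeneous {f : MvPolynomial (Fin n) k} {e : ℕ}
    (hf : f.IsHomogeneous e) (he : 0 < e) : f ∈ irrelevant k n := by
  rw [mem_irrelevant, constantCoeff_eq]
  exact hf.coeff_eq_zero (by simpa using he.ne)

theorem irrelevant_eq_span :
    irrelevant k n = Ideal.span (X '' (Set.univ : Set (Fin n))) := by
  ext f
  rw [mem_ideal_span_X_image, mem_irrelevant, constantCoeff_eq]
  constructor
  · intro h m hm
    by_contra! hcon
    have : m = 0 := by ext i; simpa using hcon i (Set.mem_univ i)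
    rw [this] at hm
    exact (mem_support_iff.1 hm) h
  · intro h
    by_contra hcon
    obtain ⟨i, -, hi⟩ := h 0 (mem_support_iff.2 hcon)
    exact hi rfl

/-- A form of positive degree is a combination of the variables. -/
theorem exists_eq_sum_X_mul {f : MvPolynomial (Fin n) k} {t : ℕ} (hf : f.IsHomogeneous (t + 1)) :
    ∃ a : Fin n → MvPolynomial (Fin n) k, (∀ i, (a i).IsHomogeneous t) ∧
      f = ∑ i, X i * a i := by
  have h := mem_irrelevant_of_isHomogeneous hf (Nat.succ_pos t)
  rw [irrelevant_eq_span, Set.image_univ, Ideal.mem_span_range_iff_exists_fun] at h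
  obtain ⟨c, hc⟩ := h
  refine ⟨fun i => homogeneousComponent t (c i), fun i => homogeneousComponent_isHomogeneous _ _, ?_⟩
  conv_lhs => rw [← homogeneousComponent_eq_self hf, ← hc, map_sum]
  refine Finset.sum_congr rfl fun i _ => ?_
  rw [mul_comm, add_comm t 1, homogeneousComponent_add_mul (isHomogeneous_X k i)]

/-- The degree `t` component of `r a` is the constant term of `r` times that of `a`, plus terms
involving lower components of `a`. Induction on `t` puts each component of `a` in `J`. -/
theorem IsHomogeneousIdeal.regMod {J : Ideal (MvPolynomial (Fin n) k)}
    (hJ : IsHomogeneousIdeal J) {r : MvPolynomial (Fin n) k} (hr : r ∉ irrelevant k n) :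
    RegMod J r := by
  rw [isHomogeneousIdeal_iff] at hJ
  intro a ha
  refine mem_of_homogeneousComponent_mem fun t => ?_
  induction t using Nat.strong_induction_on with
  | _ t ih =>
    have hkey : homogeneousComponent t (r * a) - C (constantCoeff r) * homogeneousComponent t a ∈ J := by
      rw [← homogeneousComponent_C_mul, ← map_sub, ← sub_mul]
      set r' := r - C (constantCoeff r)
      have hr' : coeff 0 r' = 0 := by simp [r', constantCoeff_eq]
      rw [← sum_homogeneousComponent a, Finset.mul_sum, map_sum]
      refine sum_mem fun i _ => ?_
      rw [mul_comm]
      rcases lt_trichotomy t i with hti | rfl | hti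
      · rw [homogeneousComponent_mul_of_lt (homogeneousComponent_isHomogeneous i a) hti]
        exact zero_mem _
      · have := homogeneousComponent_add_mul (homogeneousComponent_isHomogeneous t a) 0 r'
        rw [add_zero, homogeneousComponent_zero, hr', map_zero, mul_zero] at this
        rw [this]
        exact zero_mem _
      · exact hJ _ (J.mul_mem_right _ (ih i hti)) t
    have h1 : C (constantCoeff r) * homogeneousComponent t a ∈ J := by
      have := J.sub_mem (hJ _ ha t) hkey
      rwa [sub_sub_cancel] at this
    have h2 := J.mul_mem_left (C (constantCoeff r)⁻¹) h1
    rwa [← mul_assoc, ← map_mul, inv_mul_cancel₀ (fun h => hr (mem_irrelevant.2 h)), map_one,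
      one_mul] at h2

variable (k n) in
/-- Forms of positive degree at most `E`. -/
def formsOfDegreeLE (E : ℕ) : Set (MvPolynomial (Fin n) k) :=
  {x | ∃ e : ℕ, 0 < e ∧ e ≤ E ∧ x.IsHomogeneous e}

variable (k n) in
/-- Forms of positive degree. -/
def positiveForms : Set (MvPolynomial (Fin n) k) := {x | ∃ e : ℕ, 0 < e ∧ x.IsHomogeneous e}

variable (k n) in
/-- Linear forms. -/
def linearForms : Set (MvPolynomial (Fin n) k) := {x | x.IsHomogeneous 1}

variable (k n) in
/-- Homogeneous ideals. -/
def homogeneousIdeals : Set (Ideal (MvPolynomial (Fin n) k)) := {J | IsHomogeneousIdeal J}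

theorem linearForms_subset : linearForms k n ⊆ positiveForms k n :=
  fun _ h => ⟨1, one_pos, h⟩

theorem localLike_positiveForms :
    LocalLike (irrelevant k n) (homogeneousIdeals k n) (positiveForms k n) where
  closed _ hJ _ hr := IsHomogeneousIdeal.regMod hJ hr
  sup_mem _ hJ _ := fun ⟨_, _, hx⟩ => IsHomogeneousIdeal.sup_span_singleton hJ hx
  subset _ := fun ⟨_, he, hx⟩ => mem_irrelevant_of_isHomogeneous hx he

/-- A subspace that lies in no member of a finite set of subspaces does not lie in their union. -/
theorem exists_mem_forall_notMem [Infinite k] {V : Type*} [AddCommGroup V] [Module k V]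
    (W : Submodule k V) {s : Set (Submodule k V)} (hs : s.Finite) (h : ∀ U ∈ s, ¬ W ≤ U) :
    ∃ w ∈ W, ∀ U ∈ s, w ∉ U := by
  classical
  have := Subspace.biUnion_ne_univ_of_top_notMem
    (s := hs.toFinset.image fun U => Submodule.comap W.subtype U) (by
      intro hmem
      obtain ⟨U, hU, htop⟩ := Finset.mem_image.1 hmem
      refine h U (hs.mem_toFinset.1 hU) fun w hw => ?_
      have : (⟨w, hw⟩ : W) ∈ Submodule.comap W.subtype U := htop ▸ Submodule.mem_top
      exact this)
  obtain ⟨w, hw⟩ := (Set.ne_univ_iff_exists_notMem _).1 this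
  refine ⟨w, w.2, fun U hU hwU => hw ?_⟩
  simp only [Set.mem_iUnion]
  exact ⟨_, Finset.mem_image.2 ⟨U, hs.mem_toFinset.2 hU, rfl⟩, hwU⟩

theorem exists_mem_forall_notMem_ideal [Infinite k] (W : Submodule k (MvPolynomial (Fin n) k))
    {s : Set (Ideal (MvPolynomial (Fin n) k))} (hs : s.Finite)
    (h : ∀ P ∈ s, ∃ w ∈ W, w ∉ P) : ∃ w ∈ W, ∀ P ∈ s, w ∉ P := by
  obtain ⟨w, hw, hw'⟩ := exists_mem_forall_notMem W (hs.image (Submodule.restrictScalars k)) (by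
    rintro _ ⟨P, hP, rfl⟩ hle
    obtain ⟨w, hw, hwP⟩ := h P hP
    exact hwP (hle hw))
  exact ⟨w, hw, fun P hP => hw' _ ⟨P, hP, rfl⟩⟩

theorem exists_X_notMem {P : Ideal (MvPolynomial (Fin n) k)} (h : ¬ irrelevant k n ≤ P) :
    ∃ i, (X i : MvPolynomial (Fin n) k) ∉ P := by
  by_contra! hcon
  refine h ?_
  rw [irrelevant_eq_span, Ideal.span_le]
  rintro _ ⟨i, -, rfl⟩
  exact hcon i

/-- A prime that does not contain every variable meets the linear forms in a proper subspace, and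
over an infinite field finitely many of these do not cover. -/
theorem avoids_linearForms [Infinite k] : Avoids (irrelevant k n) (linearForms k n) := by
  intro s hs h
  refine exists_mem_forall_notMem_ideal (homogeneousSubmodule (Fin n) k 1) hs fun P hP => ?_
  obtain ⟨i, hi⟩ := exists_X_notMem (h P hP).2
  exact ⟨X i, isHomogeneous_X k i, hi⟩

theorem Avoids.mono {R : Type*} [CommRing R] {𝔪 : Ideal R} {Z X : Set R} (h : Avoids 𝔪 Z)
    (hZX : Z ⊆ X) : Avoids 𝔪 X := fun s hs hP =>
  let ⟨z, hz, h⟩ := h s hs hP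
  ⟨z, hZX hz, h⟩

theorem avoids_positiveForms [Infinite k] : Avoids (irrelevant k n) (positiveForms k n) :=
  avoids_linearForms.mono linearForms_subset

end Graded

end HomLinkage

namespace HomLinkage

/-! ### Artinian complete intersections: simple socle and vanishing in high degrees. -/

section Artinian

open MvPolynomial

variable {k : Type*} [Field k] {n : ℕ}

theorem regMod_span_X {s : Set (Fin n)} {i : Fin n} (hi : i ∉ s) :
    RegMod (Ideal.span (X '' s) : Ideal (MvPolynomial (Fin n) k)) (X i) := by
  classical
  intro a ha
  rw [mem_ideal_span_X_image] at ha ⊢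
  intro m hm
  have : m + Finsupp.single i 1 ∈ (X i * a).support := by
    rw [mem_support_iff, add_comm, coeff_X_mul]
    exact mem_support_iff.1 hm
  obtain ⟨j, hj, hne⟩ := ha _ this
  refine ⟨j, hj, ?_⟩
  have hij : i ≠ j := fun h => hi (h ▸ hj)
  simpa [Finsupp.single_apply, hij] using hne

theorem regSeq_map_X {l : List (Fin n)} {s : Set (Fin n)} (hl : l.Nodup) (hs : ∀ i ∈ l, i ∉ s) :
    RegSeq (Ideal.span (X '' s) : Ideal (MvPolynomial (Fin n) k)) (l.map X) := by
  induction l generalizing s with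
  | nil => trivial
  | cons i l ih =>
    rw [List.nodup_cons] at hl
    refine ⟨regMod_span_X (hs i (by simp)), ?_⟩
    have : (Ideal.span (X '' s) ⊔ Ideal.span {X i} : Ideal (MvPolynomial (Fin n) k)) =
        Ideal.span (X '' (insert i s)) := by
      rw [Set.image_insert_eq, Ideal.span_insert, sup_comm]
    rw [this]
    refine ih hl.2 fun j hj => ?_
    rintro (rfl | hjs)
    · exact hl.1 hj
    · exact hs j (by simp [hj]) hjs

variable (k n) in
/-- The list of the variables. -/
noncomputable def varList : List (MvPolynomial (Fin n) k) := (List.finRange n).map X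

theorem length_varList : (varList k n).length = n := by simp [varList]

theorem regSeq_varList : RegSeq (⊥ : Ideal (MvPolynomial (Fin n) k)) (varList k n) := by
  have := regSeq_map_X (k := k) (s := ∅) (List.nodup_finRange n) (by simp)
  simpa [varList] using this

theorem varList_linear : ∀ x ∈ varList k n, x ∈ linearForms k n := by
  simp [varList, linearForms, isHomogeneous_X]

theorem sup_ofList_varList :
    (⊥ ⊔ Ideal.ofList (varList k n) : Ideal (MvPolynomial (Fin n) k)) = irrelevant k n := by
  rw [bot_sup_eq, irrelevant_eq_span, Ideal.ofList]
  congr 1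
  ext x
  simp [varList]

/-- The residue ring modulo `J` has a one-dimensional socle. -/
def SimpleSocle (J : Ideal (MvPolynomial (Fin n) k)) : Prop :=
  ∃ w, w ∉ J ∧ (∀ z ∈ irrelevant k n, z * w ∈ J) ∧
    ∀ u, (∀ z ∈ irrelevant k n, z * u ∈ J) → ∃ c : k, u - C c * w ∈ J

theorem simpleSocle_irrelevant : SimpleSocle (irrelevant k n) := by
  refine ⟨1, (Ideal.ne_top_iff_one _).1 (Ideal.IsMaximal.ne_top inferInstance),
    fun z hz => by simpa using hz, fun u _ => ⟨constantCoeff u, ?_⟩⟩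
  simp [mem_irrelevant]

/-- The transport `w ↦ w'` of `hasSocle_exchange` is run in both directions: a socle element `u`
modulo `y` pulls back to `u'` with `x u ≡ y u'`, and `u' ≡ c w` modulo `J + (x)` forces `u ≡ c w'`
modulo `J + (y)`. -/
theorem SimpleSocle.exchange {J : Ideal (MvPolynomial (Fin n) k)} {x y : MvPolynomial (Fin n) k}
    (hx : x ∈ irrelevant k n) (hy : y ∈ irrelevant k n) (hxJ : RegMod J x) (hyJ : RegMod J y)
    (hs : SimpleSocle (J ⊔ Ideal.span {x})) : SimpleSocle (J ⊔ Ideal.span {y}) := by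
  obtain ⟨w, hw, hz, huniq⟩ := hs
  obtain ⟨j, hj, w', hw'⟩ := mem_sup_span_singleton_iff.1 (hz y hy)
  refine ⟨w', fun hmem => hw ?_, fun z hz' => ?_, fun u hu => ?_⟩
  · obtain ⟨j', hj', b, rfl⟩ := mem_sup_span_singleton_iff.1 hmem
    refine mem_sup_span_singleton_iff.2 ⟨w - x * b, hyJ _ ?_, b, by ring⟩
    convert J.add_mem hj (J.mul_mem_left x hj') using 1
    rw [mul_sub, hw']
    ring
  · obtain ⟨j', hj', b, hb⟩ := mem_sup_span_singleton_iff.1 (hz z hz')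
    refine mem_sup_span_singleton_iff.2 ⟨z * w' - y * b, hxJ _ ?_, b, by ring⟩
    convert J.sub_mem (J.mul_mem_left y hj') (J.mul_mem_left z hj) using 1
    linear_combination y * hb - z * hw'
  · obtain ⟨i, hi, u', hu'⟩ := mem_sup_span_singleton_iff.1 (hu x hx)
    obtain ⟨c, hc⟩ := huniq u' fun z hz => by
      obtain ⟨j', hj', b, hb⟩ := mem_sup_span_singleton_iff.1 (hu z hz)
      refine mem_sup_span_singleton_iff.2 ⟨z * u' - x * b, hyJ _ ?_, b, by ring⟩
      convert J.sub_mem (J.mul_mem_left x hj') (J.mul_mem_left z hi) using 1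
      linear_combination x * hb - z * hu'
    obtain ⟨j', hj', b, hb⟩ := mem_sup_span_singleton_iff.1 hc
    refine ⟨c, mem_sup_span_singleton_iff.2 ⟨u - C c * w' - y * b, hxJ _ ?_, b, by ring⟩⟩
    convert J.add_mem (J.add_mem hi (J.mul_mem_left y hj')) (J.mul_mem_left (C c) hj) using 1
    linear_combination hu' + y * hb + C c * hw'

/-- Graded Artinian complete intersections are Gorenstein: the forms are exchanged for the
variables, where the residue ring is `k`. -/
theorem simpleSocle_of_regSeq [Infinite k] {xs : List (MvPolynomial (Fin n) k)}
    (hxs : ∀ x ∈ xs, x ∈ positiveForms k n) (hlen : xs.length = n) (hx : RegSeq ⊥ xs) :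
    SimpleSocle (⊥ ⊔ Ideal.ofList xs) := by
  have h := localLike_positiveForms (k := k) (n := n)
  refine h.exchange (T := fun _ J => SimpleSocle J) (E := 0) linearForms_subset avoids_linearForms
    (fun _ J hJ y hy x hx hyJ hxJ hs => hs.exchange (h.subset y (linearForms_subset hy))
      (h.subset x hx) hyJ hxJ) isHomogeneousIdeal_bot (ys := varList k n) hxs varList_linear
    hlen length_varList hx regSeq_varList (s := 0) ?_
  rw [sup_ofList_varList]
  exact simpleSocle_irrelevant

/-- All forms of degree at least `s` lie in `J`. -/
def ContainsFormsFrom (s : ℕ) (J : Ideal (MvPolynomial (Fin n) k)) : Prop :=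
  ∀ t, s ≤ t → ∀ f : MvPolynomial (Fin n) k, f.IsHomogeneous t → f ∈ J

theorem containsFormsFrom_irrelevant : ContainsFormsFrom 1 (irrelevant k n) :=
  fun _ ht _ hf => mem_irrelevant_of_isHomogeneous hf ht

theorem ContainsFormsFrom.mono {s t : ℕ} (hst : s ≤ t) {J : Ideal (MvPolynomial (Fin n) k)}
    (h : ContainsFormsFrom s J) : ContainsFormsFrom t J := fun i hi => h i (hst.trans hi)

instance (t : ℕ) : Module.Finite k (homogeneousSubmodule (Fin n) k t) := by
  rw [homogeneousSubmodule_eq_finsupp_supported]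
  have : Finite {d : Fin n →₀ ℕ | d.degree = t} :=
    (Finsupp.finite_of_degree_le t).subset fun d hd => le_of_eq hd
  exact Module.Finite.of_basis (basisRestrictSupport k {d | d.degree = t})

/-- The forms of degree `t` in the residue ring modulo `J`. -/
noncomputable def gradedPiece (J : Ideal (MvPolynomial (Fin n) k)) (t : ℕ) :
    Submodule k (MvPolynomial (Fin n) k ⧸ J) :=
  (homogeneousSubmodule (Fin n) k t).map (Ideal.Quotient.mkₐ k J).toLinearMap

instance (J : Ideal (MvPolynomial (Fin n) k)) (t : ℕ) : Module.Finite k (gradedPiece J t) := by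
  unfold gradedPiece
  infer_instance

theorem mulLeft_mk_injective {J : Ideal (MvPolynomial (Fin n) k)} {x : MvPolynomial (Fin n) k}
    (hx : RegMod J x) :
    Function.Injective (LinearMap.mulLeft k (Ideal.Quotient.mk J x)) := by
  rw [injective_iff_map_eq_zero]
  intro a ha
  obtain ⟨a, rfl⟩ := Ideal.Quotient.mk_surjective a
  rw [LinearMap.mulLeft_apply, ← map_mul, Ideal.Quotient.eq_zero_iff_mem] at ha
  exact Ideal.Quotient.eq_zero_iff_mem.2 (hx a ha)

theorem finrank_map_mulLeft {J : Ideal (MvPolynomial (Fin n) k)} {x : MvPolynomial (Fin n) k}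
    (hx : RegMod J x) (V : Submodule k (MvPolynomial (Fin n) k ⧸ J)) :
    Module.finrank k (V.map (LinearMap.mulLeft k (Ideal.Quotient.mk J x))) = Module.finrank k V :=
  (Submodule.equivMapOfInjective _ (mulLeft_mk_injective hx) V).finrank_eq.symm

theorem map_mulLeft_gradedPiece_le {J : Ideal (MvPolynomial (Fin n) k)}
    {x : MvPolynomial (Fin n) k} {e : ℕ} (hx : x.IsHomogeneous e) (t : ℕ) :
    (gradedPiece J t).map (LinearMap.mulLeft k (Ideal.Quotient.mk J x)) ≤ gradedPiece J (e + t) := by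
  rintro _ ⟨_, ⟨a, ha, rfl⟩, rfl⟩
  exact ⟨x * a, hx.mul ha, by simp⟩

theorem map_mulLeft_gradedPiece_eq_iff {J : Ideal (MvPolynomial (Fin n) k)}
    (hJ : IsHomogeneousIdeal J) {x : MvPolynomial (Fin n) k} {e : ℕ} (hx : x.IsHomogeneous e)
    (t : ℕ) :
    (gradedPiece J t).map (LinearMap.mulLeft k (Ideal.Quotient.mk J x)) = gradedPiece J (e + t) ↔
      ∀ f : MvPolynomial (Fin n) k, f.IsHomogeneous (e + t) → f ∈ J ⊔ Ideal.span {x} := by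
  constructor
  · intro h f hf
    have : Ideal.Quotient.mk J f ∈ gradedPiece J (e + t) := ⟨f, hf, rfl⟩
    rw [← h] at this
    obtain ⟨_, ⟨a, -, rfl⟩, ha⟩ := this
    replace ha : Ideal.Quotient.mk J (x * a) = Ideal.Quotient.mk J f := by simpa using ha
    rw [eq_comm, Ideal.Quotient.eq] at ha
    exact mem_sup_span_singleton_iff.2 ⟨_, ha, a, by ring⟩
  · intro h
    refine le_antisymm (map_mulLeft_gradedPiece_le hx t) ?_
    rintro _ ⟨f, hf, rfl⟩
    obtain ⟨j, hj, -, b, hb, rfl⟩ := hJ.exists_decomposition hx hf (h f hf)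
    refine ⟨Ideal.Quotient.mk J b, ⟨b, hb, rfl⟩, ?_⟩
    simp [Ideal.Quotient.eq_zero_iff_mem.2 hj]

/-- Multiplication by `y` on `S/J` is injective, and onto in degrees above `s`, so the Hilbert
function of `S/J` is constant from `s` on. Multiplication by `x`, being injective between spaces of
equal finite dimension, is then onto as well. -/
theorem ContainsFormsFrom.exchange {J : Ideal (MvPolynomial (Fin n) k)}
    (hJ : IsHomogeneousIdeal J) {x y : MvPolynomial (Fin n) k} {s e : ℕ}
    (hy : y.IsHomogeneous 1) (hx : x.IsHomogeneous e) (hyJ : RegMod J y) (hxJ : RegMod J x)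
    (hs : ContainsFormsFrom s (J ⊔ Ideal.span {y})) :
    ContainsFormsFrom (s + e) (J ⊔ Ideal.span {x}) := by
  have hconst : ∀ i, Module.finrank k (gradedPiece J (i + s)) =
      Module.finrank k (gradedPiece J s) := by
    intro i
    induction i with
    | zero => rw [zero_add]
    | succ i ih =>
      have h1 := (map_mulLeft_gradedPiece_eq_iff hJ hy (i + s)).2
        fun f hf => hs _ (by omega) f hf
      rw [← ih, ← finrank_map_mulLeft hyJ (gradedPiece J (i + s)), h1,
        show i + 1 + s = 1 + (i + s) by ring]
  intro t ht f hf
  obtain ⟨i, rfl⟩ := Nat.exists_eq_add_of_le' ht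
  have h2 : e + (i + s) = i + (s + e) := by ring
  rw [← h2] at hf
  refine (map_mulLeft_gradedPiece_eq_iff hJ hx (i + s)).1 ?_ f hf
  refine Submodule.eq_of_le_of_finrank_eq (map_mulLeft_gradedPiece_le hx _) ?_
  rw [finrank_map_mulLeft hxJ, hconst, ← add_assoc, hconst]

/-- What matters is that the bound depends on `n` and `E` alone, not that it is sharp. The summand
`1` is the degree from which `S/(x_1, …, x_n)` vanishes. -/
theorem containsFormsFrom_of_regSeq [Infinite k] {E : ℕ} (hE : 1 ≤ E)
    {xs : List (MvPolynomial (Fin n) k)} (hxs : ∀ x ∈ xs, x ∈ formsOfDegreeLE k n E)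
    (hlen : xs.length = n) (hx : RegSeq ⊥ xs) :
    ContainsFormsFrom (1 + n * (2 * E)) (⊥ ⊔ Ideal.ofList xs) := by
  have h := localLike_positiveForms (k := k) (n := n)
  have hsub : formsOfDegreeLE k n E ⊆ positiveForms k n := fun x ⟨e, he, _, hx⟩ => ⟨e, he, hx⟩
  refine (h.mono hsub).exchange (T := ContainsFormsFrom) (E := E)
    (fun x hx => ⟨1, one_pos, hE, hx⟩) avoids_linearForms ?_ isHomogeneousIdeal_bot
    (ys := varList k n) hxs varList_linear hlen length_varList hx regSeq_varList ?_
  · rintro s J hJ y hy x ⟨e, -, heE, hx⟩ hyJ hxJ hs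
    exact (hs.exchange hJ hy hx hyJ hxJ).mono (by omega)
  · rw [sup_ofList_varList]
    exact containsFormsFrom_irrelevant

end Artinian

end HomLinkage

namespace HomLinkage

/-! ### Homomorphisms into `S/L` as multiplications; residuals and hypersurface sections. -/

section MultiplicationExtension

open MvPolynomial

variable {k : Type*} [Field k] {n : ℕ}

theorem exists_linearMap_comp {R A B D : Type*} [Ring R] [AddCommGroup A] [AddCommGroup B]
    [AddCommGroup D] [Module R A] [Module R B] [Module R D] (p : A →ₗ[R] B) (f : A →ₗ[R] D)
    (hp : Function.Surjective p) (h : ∀ a, p a = 0 → f a = 0) : ∃ g : B →ₗ[R] D, ∀ a, g (p a) = f a := by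
  refine ⟨(p.ker.liftQ f fun a ha => h a ha) ∘ₗ (p.quotKerEquivOfSurjective hp).symm.toLinearMap,
    fun a => ?_⟩
  have : (p.quotKerEquivOfSurjective hp).symm (p a) = Submodule.Quotient.mk a := by
    rw [LinearEquiv.symm_apply_eq]
    rfl
  simp only [LinearMap.comp_apply, LinearEquiv.coe_coe, this]
  exact Submodule.liftQ_apply _ _ _

theorem exists_linearMap_smul_eq {R A B : Type*} [CommRing R] [AddCommGroup A] [AddCommGroup B]
    [Module R A] [Module R B] {x : R} (hx : ∀ b : B, x • b = 0 → b = 0) (f : A →ₗ[R] B)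
    (h : ∀ a, ∃ b, f a = x • b) : ∃ g : A →ₗ[R] B, ∀ a, f a = x • g a := by
  choose g hg using h
  have hinj : ∀ b b' : B, x • b = x • b' → b = b' := fun b b' hb =>
    sub_eq_zero.1 (hx _ (by rw [smul_sub, hb, sub_self]))
  refine ⟨⟨⟨g, fun a a' => hinj _ _ ?_⟩, fun r a => hinj _ _ ?_⟩, hg⟩
  · rw [← hg, smul_add, ← hg, ← hg, map_add]
  · rw [← hg, RingHom.id_apply, smul_comm, ← hg, map_smul]

theorem regMod_iff_smul {R : Type*} [CommRing R] {J : Ideal R} {x : R} :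
    RegMod J x ↔ ∀ b : R ⧸ J, x • b = 0 → b = 0 := by
  constructor
  · intro h b hb
    obtain ⟨b, rfl⟩ := Ideal.Quotient.mk_surjective b
    exact Ideal.Quotient.eq_zero_iff_mem.2 (h b (Ideal.Quotient.eq_zero_iff_mem.1 hb))
  · intro h a ha
    exact Ideal.Quotient.eq_zero_iff_mem.1 (h _ (Ideal.Quotient.eq_zero_iff_mem.2 ha))

/-- Homomorphisms from `J` to the residue ring modulo `L` that vanish on `L`. -/
def homKilling {R : Type*} [CommRing R] (L J : Ideal R) : Submodule R (J →ₗ[R] R ⧸ L) where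
  carrier := {φ | ∀ j : J, (j : R) ∈ L → φ j = 0}
  add_mem' h h' j hj := by simp [h j hj, h' j hj]
  zero_mem' _ _ := rfl
  smul_mem' r φ h j hj := by simp [h j hj]

/-- Locally at the origin, each homomorphism from `J` to the residue ring modulo `L` that vanishes
on `L` is a multiplication. -/
def MultiplicationsOnly (L J : Ideal (MvPolynomial (Fin n) k)) : Prop :=
  ∀ φ ∈ homKilling L J, ∃ r s : MvPolynomial (Fin n) k, r - 1 ∈ irrelevant k n ∧
    ∀ j : J, r • φ j = Ideal.Quotient.mk L (s * j)

/-- Multiply `a` by variables as long as the product stays outside `Q`. This stops before degree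
`s`, and then the product is a socle element. -/
theorem exists_mul_mem_socle {Q : Ideal (MvPolynomial (Fin n) k)} {s : ℕ}
    (hQ : ContainsFormsFrom s Q) {a : MvPolynomial (Fin n) k} (ha : a ∉ Q) :
    ∃ b, a * b ∉ Q ∧ ∀ z ∈ irrelevant k n, z * (a * b) ∈ Q := by
  have key : ∀ i ≤ s, ∀ b : MvPolynomial (Fin n) k, b.IsHomogeneous (s - i) → a * b ∉ Q →
      ∃ b, a * b ∉ Q ∧ ∀ z ∈ irrelevant k n, z * (a * b) ∈ Q := by
    intro i
    induction i with
    | zero => exact fun _ b hb hab => absurd (Q.mul_mem_left a (hQ s le_rfl b hb)) hab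
    | succ i ih =>
      intro hi b hb hab
      by_cases hX : ∃ j, a * (X j * b) ∉ Q
      · obtain ⟨j, hj⟩ := hX
        refine ih (by omega) _ ?_ hj
        have := (isHomogeneous_X k j).mul hb
        rwa [show 1 + (s - (i + 1)) = s - i by omega] at this
      · push Not at hX
        refine ⟨b, hab, fun z hz => ?_⟩
        have : irrelevant k n ≤ Submodule.comap (LinearMap.mulRight _ (a * b)) Q := by
          rw [irrelevant_eq_span, Ideal.span_le]
          rintro _ ⟨j, -, rfl⟩
          have := hX j
          rw [mul_left_comm] at this
          exact this
        exact this hz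
  exact key s le_rfl 1 (by simpa using isHomogeneous_one (Fin n) k) (by simpa using ha)

theorem ContainsFormsFrom.finite {Q : Ideal (MvPolynomial (Fin n) k)} {s : ℕ}
    (hQ : ContainsFormsFrom s Q) : Module.Finite k (MvPolynomial (Fin n) k ⧸ Q) := by
  refine Module.Finite.of_surjective
    ((Ideal.Quotient.mkₐ k Q).toLinearMap ∘ₗ (restrictTotalDegree (Fin n) k s).subtype) ?_
  intro a
  obtain ⟨f, rfl⟩ := Ideal.Quotient.mk_surjective a
  have hmem : ∑ i ∈ Finset.range s, homogeneousComponent i f ∈ restrictTotalDegree (Fin n) k s := by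
    refine sum_mem fun i hi => ?_
    rw [mem_restrictTotalDegree]
    exact (homogeneousComponent_isHomogeneous i f).totalDegree_le.trans (Finset.mem_range.1 hi).le
  refine ⟨⟨_, hmem⟩, ?_⟩
  · change Ideal.Quotient.mk Q (∑ i ∈ Finset.range s, homogeneousComponent i f) =
      Ideal.Quotient.mk Q f
    rw [eq_comm, Ideal.Quotient.eq]
    refine mem_of_homogeneousComponent_mem fun t => ?_
    rw [map_sub, map_sum]
    rcases lt_or_ge t s with ht | ht
    · rw [Finset.sum_eq_single_of_mem t (Finset.mem_range.2 ht), homogeneousComponent_eq_self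
        (homogeneousComponent_isHomogeneous t f), sub_self]
      · exact zero_mem _
      · intro i _ hi
        rw [homogeneousComponent_of_mem (homogeneousComponent_isHomogeneous i f), if_neg hi.symm]
    · rw [Finset.sum_eq_zero, sub_zero]
      · exact hQ t ht _ (homogeneousComponent_isHomogeneous t f)
      · intro i hi
        have := Finset.mem_range.1 hi
        rw [homogeneousComponent_of_mem (homogeneousComponent_isHomogeneous i f), if_neg (by omega)]

/-- A residue ring of finite length with a one-dimensional socle is self-injective. -/
theorem multiplicationsOnly_of_simpleSocle {Q : Ideal (MvPolynomial (Fin n) k)} {s : ℕ}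
    (hQ : ContainsFormsFrom s Q) (hs : SimpleSocle Q) (J : Ideal (MvPolynomial (Fin n) k)) :
    MultiplicationsOnly Q J := by
  intro φ hφ
  have := hQ.finite
  obtain ⟨w, hw, -, huniq⟩ := hs
  obtain ⟨lam, hlam⟩ : ∃ lam : Module.Dual k (MvPolynomial (Fin n) k ⧸ Q),
      lam (Ideal.Quotient.mk Q w) ≠ 0 := by
    by_contra! hcon
    exact hw (Ideal.Quotient.eq_zero_iff_mem.1 ((Module.forall_dual_apply_eq_zero_iff k _).1 hcon))
  -- The pairing `(a, b) ↦ lam (a b)` is nondegenerate because every nonzero ideal meets the socle,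
  -- which is the line through `w`. Finite dimension then makes every functional of the form `lam
  -- (s' · _)`.
  have hnd : ∀ a : MvPolynomial (Fin n) k ⧸ Q, (∀ b, lam (a * b) = 0) → a = 0 := by
    intro a h
    obtain ⟨a, rfl⟩ := Ideal.Quotient.mk_surjective a
    by_contra hne
    obtain ⟨b, hb, hz⟩ := exists_mul_mem_socle hQ (a := a)
      fun h => hne (Ideal.Quotient.eq_zero_iff_mem.2 h)
    obtain ⟨c, hc⟩ := huniq _ hz
    have h1 : Ideal.Quotient.mk Q (a * b) = c • Ideal.Quotient.mk Q w := by
      rw [Ideal.Quotient.eq.2 hc, ← smul_eq_C_mul]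
      rfl
    have h2 := h (Ideal.Quotient.mk Q b)
    rw [← map_mul, h1, map_smul, smul_eq_mul, mul_eq_zero] at h2
    rcases h2 with rfl | h2
    · rw [zero_smul] at h1
      exact hb (Ideal.Quotient.eq_zero_iff_mem.1 h1)
    · exact hlam h2
  let Λ : (MvPolynomial (Fin n) k ⧸ Q) →ₗ[k] Module.Dual k (MvPolynomial (Fin n) k ⧸ Q) :=
    (LinearMap.mul k _).compr₂ lam
  have hΛ : Function.Surjective Λ := by
    refine (LinearMap.injective_iff_surjective_of_finrank_eq_finrank
      Subspace.dual_finrank_eq.symm).1 ?_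
    rw [injective_iff_map_eq_zero]
    intro a ha
    exact hnd a fun b => by simpa [Λ] using LinearMap.congr_fun ha b
  let p : J →ₗ[k] (MvPolynomial (Fin n) k ⧸ Q) :=
    (Ideal.Quotient.mkₐ k Q).toLinearMap ∘ₗ J.subtype.restrictScalars k
  -- As `φ` kills `J ∩ Q`, the functional `lam ∘ φ` descends to the image of `J` in `S/Q` and
  -- extends from there to all of `S/Q`.
  have hmem : lam ∘ₗ φ.restrictScalars k ∈ p.dualMap.range := by
    rw [LinearMap.range_dualMap_eq_dualAnnihilator_ker, Submodule.mem_dualAnnihilator]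
    intro j hj
    have : φ j = 0 := hφ j (Ideal.Quotient.eq_zero_iff_mem.1 hj)
    simp [this]
  obtain ⟨ψ, hψ⟩ := hmem
  obtain ⟨s', hs'⟩ := hΛ ψ
  obtain ⟨s', rfl⟩ := Ideal.Quotient.mk_surjective s'
  refine ⟨1, s', by simp, fun j => ?_⟩
  rw [one_smul, ← sub_eq_zero]
  refine hnd _ fun b => ?_
  obtain ⟨b, rfl⟩ := Ideal.Quotient.mk_surjective b
  have h1 : ψ (p (b • j)) = lam (φ (b • j)) := LinearMap.congr_fun hψ (b • j)
  rw [← hs'] at h1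
  have h2 : lam (Ideal.Quotient.mk Q s' * Ideal.Quotient.mk Q (b * j)) = lam (φ (b • j)) := h1
  have h3 : φ (b • j) = Ideal.Quotient.mk Q b * φ j := by
    obtain ⟨y, hy⟩ := Ideal.Quotient.mk_surjective (φ j)
    rw [map_smul, ← hy]
    rfl
  rw [h3] at h2
  rw [sub_mul, map_sub, mul_comm (φ j), ← h2, sub_eq_zero]
  congr 1
  simp only [map_mul]
  ring

/-- The reduction of `φ` modulo `x` is a multiplication up to a factor `r ≡ 1`, so `r φ - s ι = x
φ'`, where `ι` is the natural map to `S/L` and `φ'` again kills `L`. The homomorphisms are thus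
spanned by `ι` modulo `𝔪` times themselves, and Nakayama applies. -/
theorem MultiplicationsOnly.of_sup {L J : Ideal (MvPolynomial (Fin n) k)}
    {x : MvPolynomial (Fin n) k} (hLJ : L ≤ J) (hx : x ∈ irrelevant k n) (hxL : RegMod L x) (hxJ : RegMod J x)
    (h : MultiplicationsOnly (L ⊔ Ideal.span {x}) (J ⊔ Ideal.span {x})) :
    MultiplicationsOnly L J := by
  have hxL' := regMod_iff_smul.1 hxL
  let ι : J →ₗ[MvPolynomial (Fin n) k] MvPolynomial (Fin n) k ⧸ L := L.mkQ ∘ₗ J.subtype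
  have key : homKilling L J ≤ Submodule.span _ {ι} ⊔ irrelevant k n • homKilling L J := by
    intro φ hφ
    let J' := J ⊔ Ideal.span {x}
    let L' := L ⊔ Ideal.span {x}
    let p : (J × MvPolynomial (Fin n) k) →ₗ[MvPolynomial (Fin n) k] J' :=
      (LinearMap.coprod J.subtype (LinearMap.toSpanSingleton _ _ x)).codRestrict J' (by
        rintro ⟨j, b⟩
        exact mem_sup_span_singleton_iff.2 ⟨j, j.2, b, by simp [mul_comm]⟩)
    have hp : ∀ j b, (p (j, b) : MvPolynomial (Fin n) k) = j + b * x := fun j b => by simp [p]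
    let f : (J × MvPolynomial (Fin n) k) →ₗ[MvPolynomial (Fin n) k] MvPolynomial (Fin n) k ⧸ L' :=
      (Submodule.factor le_sup_left) ∘ₗ φ ∘ₗ LinearMap.fst _ _ _
    have hφx : ∀ (j : J) (b : MvPolynomial (Fin n) k), (j : MvPolynomial (Fin n) k) = b * x →
        Submodule.factor (le_sup_left : L ≤ L') (φ j) = 0 := by
      intro j b hb
      -- Regularity modulo `J` makes the reduction well defined: an element of `J` divisible by `x`
      -- is `x` times an element of `J`, so its image dies modulo `x`.
      have hbJ : b ∈ J := hxJ b (by rw [mul_comm, ← hb]; exact j.2)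
      have : j = x • (⟨b, hbJ⟩ : J) := Subtype.ext (by simp [hb, mul_comm])
      rw [this, map_smul, map_smul]
      obtain ⟨c, hc⟩ := Submodule.Quotient.mk_surjective L (φ ⟨b, hbJ⟩)
      rw [← hc]
      refine (Submodule.Quotient.mk_eq_zero L').2 ?_
      exact Ideal.mem_sup_right (Ideal.mul_mem_right _ _ (Ideal.mem_span_singleton_self x))
    obtain ⟨g, hg⟩ := exists_linearMap_comp p f (by
        rintro ⟨a, ha⟩
        obtain ⟨j, hj, b, rfl⟩ := mem_sup_span_singleton_iff.1 ha
        exact ⟨(⟨j, hj⟩, b), Subtype.ext (by rw [hp, mul_comm])⟩) (by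
        rintro ⟨j, b⟩ h0
        refine hφx j (-b) ?_
        have := congrArg Subtype.val h0
        rw [hp] at this
        have h2 : (j : MvPolynomial (Fin n) k) + b * x = 0 := this
        linear_combination h2)
    have hgk : g ∈ homKilling L' J' := by
      rintro ⟨a, ha⟩ haL
      obtain ⟨l, hl, b, rfl⟩ := mem_sup_span_singleton_iff.1 haL
      have h1 : (⟨l + x * b, ha⟩ : J') = p (⟨l, hLJ hl⟩, b) :=
        Subtype.ext (by rw [hp, mul_comm b])
      rw [h1, hg]
      change Submodule.factor (le_sup_left : L ≤ L') (φ ⟨l, hLJ hl⟩) = 0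
      rw [hφ _ hl, map_zero]
    obtain ⟨r, s, hr, hrs⟩ := h g hgk
    obtain ⟨φ', hφ'⟩ := exists_linearMap_smul_eq hxL' (r • φ - s • ι) (by
      intro j
      have h1 := hrs (p (j, 0))
      rw [hg] at h1
      obtain ⟨c, hc⟩ := Ideal.Quotient.mk_surjective (φ j)
      have h2 : Ideal.Quotient.mk L' (r * c) = Ideal.Quotient.mk L' (s * (p (j, 0))) := by
        rw [← h1]
        change _ = r • Submodule.factor (le_sup_left : L ≤ L') (φ j)
        rw [← hc]
        rfl
      rw [hp, zero_mul, add_zero, Ideal.Quotient.eq] at h2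
      obtain ⟨l, hl, b, hb⟩ := mem_sup_span_singleton_iff.1 h2
      refine ⟨Ideal.Quotient.mk L b, ?_⟩
      change r • φ j - s • ι j = _
      rw [← hc]
      change Ideal.Quotient.mk L (r * c - s * j) = Ideal.Quotient.mk L (x * b)
      rw [Ideal.Quotient.eq, hb]
      simpa using hl)
    have hφk : φ' ∈ homKilling L J := by
      intro j hj
      refine hxL' _ ?_
      rw [← hφ' j]
      change r • φ j - s • ι j = 0
      have : ι j = 0 := Ideal.Quotient.eq_zero_iff_mem.2 hj
      rw [hφ j hj, this, smul_zero, smul_zero, sub_zero]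
    have heq : φ = s • ι + (x • φ' - (r - 1) • φ) := by
      ext1 j
      change φ j = s • ι j + (x • φ' j - (r - 1) • φ j)
      rw [← hφ' j]
      change φ j = s • ι j + (r • φ j - s • ι j - (r - 1) • φ j)
      rw [sub_smul, one_smul]
      abel
    rw [heq]
    exact add_mem (Submodule.mem_sup_left (Submodule.smul_mem _ _
      (Submodule.mem_span_singleton_self ι)))
      (Submodule.mem_sup_right (sub_mem (Submodule.smul_mem_smul hx hφk)
        (Submodule.smul_mem_smul hr hφ)))
  obtain ⟨r, hr, hle⟩ := Submodule.exists_sub_one_mem_and_smul_le_of_fg_of_le_sup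
    (IsNoetherian.noetherian _) le_rfl key
  intro φ hφ
  obtain ⟨s, hs⟩ := Submodule.mem_span_singleton.1
    (hle (Submodule.smul_mem_pointwise_smul φ r _ hφ))
  refine ⟨r, s, hr, fun j => ?_⟩
  have := LinearMap.congr_fun hs j
  exact this.symm

/-- Residuals commute with hypersurface sections. -/
theorem MultiplicationsOnly.colon_sup {L J : Ideal (MvPolynomial (Fin n) k)}
    (h : MultiplicationsOnly L J) (hL : IsHomogeneousIdeal L) (hJ : IsHomogeneousIdeal J)
    {x : MvPolynomial (Fin n) k} {e : ℕ} (hx : x.IsHomogeneous e) (hxL : RegMod L x) :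
    Submodule.colon (L ⊔ Ideal.span {x}) ((J ⊔ Ideal.span {x} : Ideal (MvPolynomial (Fin n) k)) :
      Set (MvPolynomial (Fin n) k)) =
    Submodule.colon L (J : Set (MvPolynomial (Fin n) k)) ⊔ Ideal.span {x} := by
  refine le_antisymm (fun y hy => ?_) (sup_le (fun y hy => ?_) ?_)
  · rw [Submodule.mem_colon] at hy
    -- Multiplication by `y` on `J` is `x φ` modulo `L`. If `r φ` is multiplication by `s`, then `r
    -- y - x s` lies in `L : J`, and `r`, with nonzero constant term, cancels modulo the homogeneous
    -- ideal `(L : J) + (x)`.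
    obtain ⟨φ, hφ⟩ := exists_linearMap_smul_eq (regMod_iff_smul.1 hxL)
      (L.mkQ ∘ₗ LinearMap.mulLeft (MvPolynomial (Fin n) k) y ∘ₗ J.subtype) (by
        intro j
        obtain ⟨l, hl, b, hb⟩ := mem_sup_span_singleton_iff.1 (hy j (Ideal.mem_sup_left j.2))
        refine ⟨Ideal.Quotient.mk L b, ?_⟩
        change Ideal.Quotient.mk L (y * j) = Ideal.Quotient.mk L (x * b)
        rw [smul_eq_mul] at hb
        rw [Ideal.Quotient.eq, hb]
        simpa using hl)
    replace hφ : ∀ j : J, Ideal.Quotient.mk L (y * j) = x • φ j := hφ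
    obtain ⟨r, s, hr, hrs⟩ := h φ fun j hj => regMod_iff_smul.1 hxL _ (by
      rw [← hφ, Ideal.Quotient.eq_zero_iff_mem]
      exact L.mul_mem_left y hj)
    have hr' : r ∉ irrelevant k n := fun hrm => by
      have := (irrelevant k n).sub_mem hrm hr
      rw [sub_sub_cancel] at this
      exact (Ideal.ne_top_iff_one _).1 (Ideal.IsMaximal.ne_top inferInstance) this
    refine ((isHomogeneousIdeal_colon hL hJ).sup_span_singleton hx).regMod hr' y ?_
    refine mem_sup_span_singleton_iff.2 ⟨r * y - x * s, ?_, s, by ring⟩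
    rw [Submodule.mem_colon]
    intro j hj
    have h1 : Ideal.Quotient.mk L (r * (y * j)) = Ideal.Quotient.mk L (x * (s * j)) := by
      have h2 : Ideal.Quotient.mk L (r * (y * j)) = r • Ideal.Quotient.mk L (y * j) := rfl
      have h3 : Ideal.Quotient.mk L (x * (s * j)) = x • Ideal.Quotient.mk L (s * j) := rfl
      rw [h2, h3, hφ ⟨j, hj⟩, smul_comm, hrs ⟨j, hj⟩]
    rw [Ideal.Quotient.eq] at h1
    convert h1 using 1
    rw [smul_eq_mul]
    ring
  · rw [Submodule.mem_colon] at hy ⊢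
    intro a ha
    obtain ⟨j, hj, b, rfl⟩ := mem_sup_span_singleton_iff.1 ha
    exact mem_sup_span_singleton_iff.2 ⟨_, hy j hj, y * b, by simp only [smul_eq_mul]; ring⟩
  · rw [Ideal.span_singleton_le_iff_mem, Submodule.mem_colon]
    intro a _
    exact Ideal.mul_mem_right _ _ (self_mem_sup_span_singleton L x)

theorem regMod_colon {R : Type*} [CommRing R] {L : Ideal R} (J : Ideal R) {x : R}
    (hx : RegMod L x) : RegMod (Submodule.colon L (J : Set R)) x := by
  intro a ha
  rw [Submodule.mem_colon] at ha ⊢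
  intro j hj
  refine hx _ ?_
  simpa [mul_assoc] using ha j hj

/-- Regular sequences modulo `L` and `J` stay regular modulo the residual of `J`. -/
theorem multiplicationsOnly_and_regSeq_colon {xs : List (MvPolynomial (Fin n) k)}
    (hxs : ∀ x ∈ xs, x ∈ positiveForms k n) {L J : Ideal (MvPolynomial (Fin n) k)}
    (hL : IsHomogeneousIdeal L) (hJ : IsHomogeneousIdeal J) (hLJ : L ≤ J) {s : ℕ}
    (hs : SimpleSocle (L ⊔ Ideal.ofList xs)) (hc : ContainsFormsFrom s (L ⊔ Ideal.ofList xs))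
    (hxL : RegSeq L xs) (hxJ : RegSeq J xs) :
    MultiplicationsOnly L J ∧ RegSeq (Submodule.colon L (J : Set (MvPolynomial (Fin n) k))) xs := by
  induction xs generalizing L J with
  | nil =>
    rw [Ideal.ofList_nil, sup_bot_eq] at hs hc
    exact ⟨multiplicationsOnly_of_simpleSocle hc hs J, trivial⟩
  | cons x xs ih =>
    rw [sup_ofList_cons] at hs hc
    obtain ⟨e, he, hx⟩ := hxs x (by simp)
    obtain ⟨h1, h2⟩ := ih (fun y hy => hxs y (by simp [hy])) (hL.sup_span_singleton hx)
      (hJ.sup_span_singleton hx) (sup_le_sup_right hLJ _) hs hc hxL.2 hxJ.2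
    have h3 := h1.of_sup hLJ (mem_irrelevant_of_isHomogeneous hx he) hxL.1 hxJ.1
    refine ⟨h3, regMod_colon J hxL.1, ?_⟩
    rwa [← h3.colon_sup hL hJ hx hxL.1]

end MultiplicationExtension

end HomLinkage

namespace HomLinkage

/-! ### Regular sequences and heights. -/

section Heights

variable {R : Type*} [CommRing R]

theorem isSMulRegular_quotient_iff {J : Ideal R} {x : R} :
    IsSMulRegular (R ⧸ J) x ↔ RegMod J x := by
  rw [regMod_iff_smul]
  exact isSMulRegular_iff_right_eq_zero_of_smul

theorem isWeaklyRegular_iff_regSeq {xs : List R} :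
    RingTheory.Sequence.IsWeaklyRegular R xs ↔ RegSeq ⊥ xs := by
  induction xs using List.reverseRecOn with
  | nil => exact ⟨fun _ => trivial, fun _ => .nil R R⟩
  | append_singleton xs x ih =>
    rw [RingTheory.Sequence.isWeaklyRegular_append_iff,
      RingTheory.Sequence.isWeaklyRegular_singleton_iff, regSeq_concat, ih, bot_sup_eq,
      ← isSMulRegular_quotient_iff, smul_eq_mul, Ideal.mul_top]

theorem isAss_of_mem_minimalPrimes [IsNoetherianRing R] {J P : Ideal R}
    (h : P ∈ J.minimalPrimes) : IsAss J P := by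
  refine isAss_of_mem_associatedPrimes
    (Module.associatedPrimes.minimalPrimes_annihilator_subset_associatedPrimes R (R ⧸ J) ?_)
  rwa [Ideal.annihilator_quotient]

/-- Minimal primes are associated, so a regular element avoids them and each new element enlarges
the prime strictly. -/
theorem length_le_height_of_isPrime [IsNoetherianRing R] {J : Ideal R} {xs : List R}
    (hx : RegSeq J xs) {P : Ideal R} [P.IsPrime] (hP : J ⊔ Ideal.ofList xs ≤ P) :
    (xs.length : ℕ∞) ≤ P.height := by
  induction xs using List.reverseRecOn generalizing P with
  | nil => simp
  | append_singleton xs x ih =>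
    obtain ⟨h1, h2⟩ := regSeq_concat.1 hx
    rw [sup_ofList_concat] at hP
    obtain ⟨Q, hQ, hQP⟩ := Ideal.exists_minimalPrimes_le (le_sup_left.trans hP)
    have hQprime := hQ.isPrime
    have hlt : Q < P := by
      refine lt_of_le_of_ne hQP ?_
      rintro rfl
      exact (isAss_of_mem_minimalPrimes hQ).notMem_of_regMod h2 (hP (self_mem_sup_span_singleton _ x))
    calc ((xs ++ [x]).length : ℕ∞) = xs.length + 1 := by simp
      _ ≤ Q.height + 1 := by gcongr; exact ih h1 hQ.le
      _ ≤ P.height := Ideal.height_add_one_le_of_lt_of_isPrime hlt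

theorem length_le_height [IsNoetherianRing R] {J : Ideal R} {xs : List R}
    (hx : RegSeq J xs) {I : Ideal R} (hI : J ⊔ Ideal.ofList xs ≤ I) :
    (xs.length : ℕ∞) ≤ I.height := by
  rw [Ideal.height_eq_inf_minimalPrimes]
  refine le_iInf₂ fun P hP => ?_
  have := hP.isPrime
  exact length_le_height_of_isPrime hx (hI.trans hP.le)

theorem height_span_range_le [IsNoetherianRing R] {m : ℕ} (f : Fin m → R)
    (h : Ideal.span (Set.range f) ≠ ⊤) : (Ideal.span (Set.range f)).height ≤ m := by
  obtain ⟨P, hP⟩ := Ideal.nonempty_minimalPrimes h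
  rw [Ideal.height_eq_inf_minimalPrimes]
  refine (iInf₂_le P hP).trans
    ((Ideal.height_le_card_of_mem_minimalPrimes_span (Set.finite_range f) hP).trans ?_)
  have : (Set.range f).ncard ≤ m := by
    rw [← Set.image_univ]
    exact (Set.ncard_image_le Set.finite_univ).trans (by simp [Set.ncard_univ])
  exact_mod_cast this

end Heights

/-! ### Homogeneous complete intersections and sequences of linear forms. -/

section CompleteIntersections

open MvPolynomial

variable {k : Type*} [Field k] {n : ℕ}

theorem ofList_ofFn {R : Type*} [CommRing R] {m : ℕ} (f : Fin m → R) :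
    Ideal.ofList (List.ofFn f) = Ideal.span (Set.range f) := by
  rw [Ideal.ofList]
  congr 1
  ext x
  simp [List.mem_ofFn]

theorem span_range_le_irrelevant {c : ℕ} {e : Fin c → ℕ} {f : Fin c → MvPolynomial (Fin n) k}
    (hf : ∀ i, (f i).IsHomogeneous (e i)) (he : ∀ i, 0 < e i) :
    Ideal.span (Set.range f) ≤ irrelevant k n := by
  rw [Ideal.span_le]
  rintro _ ⟨i, rfl⟩
  exact mem_irrelevant_of_isHomogeneous (hf i) (he i)

/-- A generator of degree `0` is a unit or zero. A unit generates everything, and zero is regular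
only modulo the unit ideal; both contradict properness. Positive degrees in turn give properness, as
all generators vanish at the origin. -/
theorem isCompleteIntersection_iff {c : ℕ} {e : Fin c → ℕ} {L : Ideal (MvPolynomial (Fin n) k)} :
    IsCompleteIntersection e L ↔ (∀ i, 0 < e i) ∧ ∃ f : Fin c → MvPolynomial (Fin n) k,
      (∀ i, (f i).IsHomogeneous (e i)) ∧ RegSeq ⊥ (List.ofFn f) ∧ L = Ideal.span (Set.range f) := by
  constructor
  · rintro ⟨f, hf, hreg, rfl⟩
    have hne : Ideal.span (Set.range f) ≠ ⊤ := by
      have := hreg.top_ne_smul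
      rw [smul_eq_mul, Ideal.mul_top, ofList_ofFn] at this
      exact this.symm
    refine ⟨fun i => ?_, f, hf, isWeaklyRegular_iff_regSeq.1 hreg.toIsWeaklyRegular, rfl⟩
    by_contra hi
    have h0 : (f i).IsHomogeneous 0 := by
      have := hf i
      rwa [Nat.eq_zero_of_not_pos hi] at this
    obtain ⟨a, ha⟩ : ∃ a, f i = C a := ⟨_, totalDegree_eq_zero_iff_eq_C.1
      (Nat.le_zero.1 h0.totalDegree_le)⟩
    by_cases haz : a = 0
    · have h1 := hreg.toIsWeaklyRegular.regular_mod_prev i (by simp)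
      rw [smul_eq_mul, Ideal.mul_top, isSMulRegular_quotient_iff] at h1
      have h2 := h1 1 (by simp [ha, haz])
      refine hne ((Ideal.eq_top_iff_one _).2 ?_)
      rw [← ofList_ofFn]
      exact Ideal.span_mono (fun x hx => List.mem_of_mem_take hx) h2
    · refine hne ((Ideal.eq_top_iff_one _).2 ?_)
      have h1 : f i ∈ Ideal.span (Set.range f) := Ideal.subset_span ⟨i, rfl⟩
      have h2 := Ideal.mul_mem_left _ (C a⁻¹) h1
      rwa [ha, ← C_mul, inv_mul_cancel₀ haz, C_1] at h2
  · rintro ⟨he, f, hf, hreg, rfl⟩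
    refine ⟨f, hf, ⟨isWeaklyRegular_iff_regSeq.2 hreg, fun h => ?_⟩, rfl⟩
    rw [smul_eq_mul, Ideal.mul_top, ofList_ofFn] at h
    exact Ideal.IsMaximal.ne_top (inferInstanceAs (irrelevant k n).IsMaximal)
      (top_le_iff.1 (h.le.trans (span_range_le_irrelevant hf he)))

theorem mem_positiveForms_of_mem_ofFn {c : ℕ} {e : Fin c → ℕ}
    {f : Fin c → MvPolynomial (Fin n) k} (hf : ∀ i, (f i).IsHomogeneous (e i))
    (he : ∀ i, 0 < e i) : ∀ x ∈ List.ofFn f, x ∈ positiveForms k n := by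
  intro x hx
  obtain ⟨i, rfl⟩ := List.mem_ofFn.1 hx
  exact ⟨e i, he i, hf i⟩

theorem IsCompleteIntersection.le_irrelevant {c : ℕ} {e : Fin c → ℕ}
    {L : Ideal (MvPolynomial (Fin n) k)} (h : IsCompleteIntersection e L) :
    L ≤ irrelevant k n := by
  obtain ⟨he, f, hf, -, rfl⟩ := isCompleteIntersection_iff.1 h
  exact span_range_le_irrelevant hf he

theorem IsHomogeneousIdeal.le_irrelevant {I : Ideal (MvPolynomial (Fin n) k)}
    (h : IsHomogeneousIdeal I) (hI : I ≠ ⊤) : I ≤ irrelevant k n := by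
  intro r hr
  by_contra hrm
  exact hI ((Ideal.eq_top_iff_one _).2 (h.regMod hrm 1 (by simpa using hr)))

theorem ne_top_of_le_irrelevant {I : Ideal (MvPolynomial (Fin n) k)} (h : I ≤ irrelevant k n) :
    I ≠ ⊤ := by
  rintro rfl
  exact Ideal.IsMaximal.ne_top (inferInstanceAs (irrelevant k n).IsMaximal) (top_le_iff.1 h)

theorem IsCompleteIntersection.isHomogeneousIdeal {c : ℕ} {e : Fin c → ℕ}
    {L : Ideal (MvPolynomial (Fin n) k)} (h : IsCompleteIntersection e L) :
    IsHomogeneousIdeal L := by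
  obtain ⟨he, f, hf, -, rfl⟩ := isCompleteIntersection_iff.1 h
  rw [← ofList_ofFn, ← bot_sup_eq (Ideal.ofList _)]
  refine isHomogeneousIdeal_ofList (fun x hx => ?_) isHomogeneousIdeal_bot
  obtain ⟨i, rfl⟩ := List.mem_ofFn.1 hx
  exact ⟨e i, hf i⟩

theorem IsCompleteIntersection.le_height {c : ℕ} {e : Fin c → ℕ}
    {L I : Ideal (MvPolynomial (Fin n) k)} (h : IsCompleteIntersection e L) (hLI : L ≤ I) :
    (c : ℕ∞) ≤ I.height := by
  obtain ⟨he, f, hf, hreg, rfl⟩ := isCompleteIntersection_iff.1 h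
  have := length_le_height hreg (I := I) (by rwa [ofList_ofFn, bot_sup_eq])
  simpa using this

theorem IsCompleteIntersection.height_eq {c : ℕ} {e : Fin c → ℕ}
    {L : Ideal (MvPolynomial (Fin n) k)} (h : IsCompleteIntersection e L) : L.height = c := by
  refine le_antisymm ?_ (h.le_height le_rfl)
  have hne := ne_top_of_le_irrelevant h.le_irrelevant
  obtain ⟨he, f, hf, hreg, rfl⟩ := isCompleteIntersection_iff.1 h
  exact height_span_range_le f hne

theorem height_irrelevant_le : (irrelevant k n).height ≤ n := by
  have h1 := Ideal.height_le_ringKrullDim_of_ne_top (I := irrelevant k n)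
    (ne_top_of_le_irrelevant le_rfl)
  rw [MvPolynomial.ringKrullDim_of_isNoetherianRing, ringKrullDim_eq_zero_of_field, zero_add] at h1
  simp only [Nat.card_eq_fintype_card, Fintype.card_fin] at h1
  exact_mod_cast h1

/-- Associated primes of a homogeneous ideal `J` with a regular sequence of forms modulo `J`. -/
theorem IsAss.height_add_length_le {J : Ideal (MvPolynomial (Fin n) k)}
    (hJ : IsHomogeneousIdeal J) {xs : List (MvPolynomial (Fin n) k)}
    (hxs : ∀ x ∈ xs, x ∈ positiveForms k n) (hx : RegSeq J xs)
    {P : Ideal (MvPolynomial (Fin n) k)} (hP : IsAss J P) :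
    P.height + xs.length ≤ n := by
  refine (localLike_positiveForms.height_like_add_length_le Ideal.height (I := ⊥)
    (fun P Q hP hQ _ hPQ => ?_) hJ hxs hx hP bot_le).trans height_irrelevant_le
  exact Ideal.height_add_one_le_of_lt_of_isPrime hPQ

/-- There is a regular sequence of `m` linear forms modulo `I`. -/
def HasLinearRegSeq (m : ℕ) (I : Ideal (MvPolynomial (Fin n) k)) : Prop :=
  ∃ xs : List (MvPolynomial (Fin n) k), (∀ x ∈ xs, x ∈ linearForms k n) ∧ xs.length = m ∧
    RegSeq I xs

theorem HasLinearRegSeq.exists_extension [Infinite k] {m : ℕ} {I : Ideal (MvPolynomial (Fin n) k)}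
    (h : HasLinearRegSeq m I) (hI : IsHomogeneousIdeal I) {xs : List (MvPolynomial (Fin n) k)}
    (hxs : ∀ x ∈ xs, x ∈ positiveForms k n) (hx : RegSeq I xs) (hle : xs.length ≤ m) :
    ∃ zs : List (MvPolynomial (Fin n) k), (∀ z ∈ zs, z ∈ linearForms k n) ∧
      xs.length + zs.length = m ∧ RegSeq I (xs ++ zs) := by
  obtain ⟨ys, hys, rfl, hy⟩ := h
  exact localLike_positiveForms.exists_regSeq_extension avoids_positiveForms linearForms_subset
    avoids_linearForms hI hxs (fun y h => linearForms_subset (hys y h)) hle hx hy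

theorem HasLinearRegSeq.sup [Infinite k] {m : ℕ} {I : Ideal (MvPolynomial (Fin n) k)}
    (h : HasLinearRegSeq (m + 1) I) (hI : IsHomogeneousIdeal I) {x : MvPolynomial (Fin n) k}
    (hx : x ∈ positiveForms k n) (hxI : RegMod I x) :
    HasLinearRegSeq m (I ⊔ Ideal.span {x}) := by
  obtain ⟨zs, h1, h2, h3⟩ := h.exists_extension hI (xs := [x]) (by simpa using hx) ⟨hxI, trivial⟩
    (by simp)
  exact ⟨zs, h1, by simp at h2; omega, h3.2⟩

theorem HasLinearRegSeq.not_hasSocle [Infinite k] {m : ℕ} {I : Ideal (MvPolynomial (Fin n) k)}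
    (h : HasLinearRegSeq (m + 1) I) : ¬ HasSocle (irrelevant k n) I := by
  obtain ⟨ys, hys, hlen, hy⟩ := h
  match ys, hlen with
  | y :: ys, _ =>
    exact hy.1.not_hasSocle (mem_irrelevant_of_isHomogeneous (hys y (by simp)) one_pos)

/-- With `m = n - c` this is the unmixedness needed later: no associated prime has height above `c`.
-/
theorem HasLinearRegSeq.height_add_le {m : ℕ} {I : Ideal (MvPolynomial (Fin n) k)}
    (h : HasLinearRegSeq m I) (hI : IsHomogeneousIdeal I) {P : Ideal (MvPolynomial (Fin n) k)}
    (hP : IsAss I P) : P.height + m ≤ n := by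
  obtain ⟨ys, hys, rfl, hy⟩ := h
  exact hP.height_add_length_le hI (fun y h => linearForms_subset (hys y h)) hy

theorem HasLinearRegSeq.height_ideal_add_le {m : ℕ} {I : Ideal (MvPolynomial (Fin n) k)}
    (h : HasLinearRegSeq m I) (hI : IsHomogeneousIdeal I) (hne : I ≠ ⊤) :
    I.height + m ≤ n := by
  obtain ⟨P, hP, -⟩ := exists_isAss_of_notMem ((Ideal.ne_top_iff_one I).1 hne)
  exact (add_le_add_left (Ideal.height_mono hP.le) _).trans (h.height_add_le hI hP)

theorem hasLinearRegSeq_of_regSeq [Infinite k] {xs : List (MvPolynomial (Fin n) k)}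
    (hxs : ∀ x ∈ xs, x ∈ positiveForms k n) (hx : RegSeq ⊥ xs) (hle : xs.length ≤ n) :
    HasLinearRegSeq (n - xs.length) (⊥ ⊔ Ideal.ofList xs) := by
  obtain ⟨zs, h1, h2, h3⟩ := HasLinearRegSeq.exists_extension (m := n)
    ⟨varList k n, varList_linear, length_varList, regSeq_varList⟩ isHomogeneousIdeal_bot hxs hx hle
  exact ⟨zs, h1, by omega, (regSeq_append.1 h3).2⟩

theorem IsCompleteIntersection.length_le {c : ℕ} {e : Fin c → ℕ}
    {L : Ideal (MvPolynomial (Fin n) k)} (h : IsCompleteIntersection e L) : c ≤ n := by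
  have := (h.le_height h.le_irrelevant).trans height_irrelevant_le
  exact_mod_cast this

theorem IsCompleteIntersection.hasLinearRegSeq [Infinite k] {c : ℕ} {e : Fin c → ℕ}
    {L : Ideal (MvPolynomial (Fin n) k)} (h : IsCompleteIntersection e L) :
    HasLinearRegSeq (n - c) L := by
  have hc := h.length_le
  obtain ⟨he, f, hf, hreg, rfl⟩ := isCompleteIntersection_iff.1 h
  have := hasLinearRegSeq_of_regSeq (mem_positiveForms_of_mem_ofFn hf he) hreg (by simpa using hc)
  rwa [List.length_ofFn, bot_sup_eq, ofList_ofFn] at this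

end CompleteIntersections

end HomLinkage

namespace HomLinkage

/-! ### Local rings as a second instance of the formalism. -/

section LocalRings

variable {A : Type*} [CommRing A] [IsLocalRing A]

theorem localLike_maximalIdeal :
    LocalLike (IsLocalRing.maximalIdeal A) Set.univ (IsLocalRing.maximalIdeal A : Set A) where
  closed J _ r hr a ha := by
    rw [IsLocalRing.mem_maximalIdeal, mem_nonunits_iff, not_not] at hr
    exact (Ideal.unit_mul_mem_iff_mem J hr).1 ha
  sup_mem _ _ _ _ := Set.mem_univ _
  subset _ hx := hx

theorem avoids_maximalIdeal :
    Avoids (IsLocalRing.maximalIdeal A) (IsLocalRing.maximalIdeal A : Set A) := by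
  intro s hs h
  by_contra! hcon
  have hsub : (IsLocalRing.maximalIdeal A : Set A) ⊆ ⋃ P ∈ (hs.toFinset : Set (Ideal A)), P := by
    intro z hz
    obtain ⟨P, hP, hzP⟩ := hcon z hz
    exact Set.mem_biUnion (by simpa using hP) hzP
  obtain ⟨P, hP, hle⟩ := (Ideal.subset_union_prime (f := fun P : Ideal A => P) ⊤ ⊤
    fun P hP _ _ => (h P (by simpa using hP)).1).1 hsub
  exact (h P (by simpa using hP)).2 hle

end LocalRings

/-! ### From Cohen-Macaulay residue rings to regular sequences of linear forms. -/

section CohenMacaulay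

open MvPolynomial

variable {k : Type*} [Field k] {n : ℕ}

/-- A ring homomorphism that behaves like the localization at the origin of the quotient map
modulo an ideal. -/
structure IsLocalQuotientMap {A : Type*} [CommRing A] [IsLocalRing A]
    (I : Ideal (MvPolynomial (Fin n) k)) (ψ : MvPolynomial (Fin n) k →+* A) : Prop where
  isUnit : ∀ r ∉ irrelevant k n, IsUnit (ψ r)
  mem : ∀ r ∈ irrelevant k n, ψ r ∈ IsLocalRing.maximalIdeal A
  exists_mul_eq : ∀ a, ∃ r ∉ irrelevant k n, ∃ b, ψ r * a = ψ b
  exists_mem : ∀ J, I ≤ J → ∀ b, ψ b ∈ J.map ψ → ∃ r ∉ irrelevant k n, r * b ∈ J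

namespace IsLocalQuotientMap

variable {A : Type*} [CommRing A] [IsLocalRing A] {I : Ideal (MvPolynomial (Fin n) k)}
  {ψ : MvPolynomial (Fin n) k →+* A}

theorem mem_of_mem (h : IsLocalQuotientMap I ψ) {J : Ideal (MvPolynomial (Fin n) k)}
    (hJ : IsHomogeneousIdeal J) (hIJ : I ≤ J) {b : MvPolynomial (Fin n) k} (hb : ψ b ∈ J.map ψ) :
    b ∈ J := by
  obtain ⟨r, hr, hrb⟩ := h.exists_mem J hIJ b hb
  exact hJ.regMod hr b hrb

theorem regMod (h : IsLocalQuotientMap I ψ) {J : Ideal (MvPolynomial (Fin n) k)}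
    (hJ : IsHomogeneousIdeal J) (hIJ : I ≤ J) {x : MvPolynomial (Fin n) k} (hx : RegMod J x) :
    RegMod (J.map ψ) (ψ x) := by
  intro a ha
  obtain ⟨r, hr, b, hb⟩ := h.exists_mul_eq a
  rw [← Ideal.unit_mul_mem_iff_mem _ (h.isUnit r hr), hb]
  refine Ideal.mem_map_of_mem ψ (hx b (h.mem_of_mem hJ hIJ ?_))
  rw [map_mul, ← hb, mul_left_comm]
  exact Ideal.mul_mem_left _ _ ha

theorem regSeq (h : IsLocalQuotientMap I ψ) {J : Ideal (MvPolynomial (Fin n) k)}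
    (hJ : IsHomogeneousIdeal J) (hIJ : I ≤ J) {xs : List (MvPolynomial (Fin n) k)}
    (hxs : ∀ x ∈ xs, x ∈ linearForms k n) (hx : RegSeq J xs) :
    RegSeq (J.map ψ) (xs.map ψ) := by
  induction xs generalizing J with
  | nil => trivial
  | cons x xs ih =>
    refine ⟨h.regMod hJ hIJ hx.1, ?_⟩
    have := ih (hJ.sup_span_singleton (hxs x (by simp))) (hIJ.trans le_sup_left)
      (fun y hy => hxs y (by simp [hy])) hx.2
    rwa [Ideal.map_sup, Ideal.map_span, Set.image_singleton] at this

theorem hasSocle (h : IsLocalQuotientMap I ψ) {J : Ideal (MvPolynomial (Fin n) k)}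
    (hJ : IsHomogeneousIdeal J) (hIJ : I ≤ J) (hs : HasSocle (irrelevant k n) J) :
    HasSocle (IsLocalRing.maximalIdeal A) (J.map ψ) := by
  obtain ⟨u, hu, hz⟩ := hs
  refine ⟨ψ u, fun hmem => hu (h.mem_of_mem hJ hIJ hmem), fun a ha => ?_⟩
  obtain ⟨r, hr, b, hb⟩ := h.exists_mul_eq a
  have hbm : b ∈ irrelevant k n := by
    by_contra hbm
    have := h.isUnit b hbm
    rw [← hb] at this
    exact ((IsLocalRing.mem_maximalIdeal a).1 ha) (isUnit_of_mul_isUnit_right this)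
  rw [← Ideal.unit_mul_mem_iff_mem _ (h.isUnit r hr), ← mul_assoc, hb, ← map_mul]
  exact Ideal.mem_map_of_mem ψ (hz b hbm)

/-- Linear forms are appended one by one. A socle element modulo those already chosen would survive
in `A`, where the longer regular sequence `ys` excludes it. -/
theorem hasLinearRegSeq [Infinite k] [IsNoetherianRing A] (h : IsLocalQuotientMap I ψ)
    (hI : IsHomogeneousIdeal I) (hψ : I.map ψ = ⊥) {ys : List A}
    (hys : ∀ y ∈ ys, y ∈ IsLocalRing.maximalIdeal A) (hy : RegSeq ⊥ ys) {m : ℕ}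
    (hm : m ≤ ys.length) : HasLinearRegSeq m I := by
  induction m with
  | zero => exact ⟨[], by simp, rfl, trivial⟩
  | succ m ih =>
    obtain ⟨xs, h1, h2, h3⟩ := ih (by omega)
    have h4 := h.regSeq hI le_rfl h1 h3
    rw [hψ] at h4
    have h5 : ∀ x ∈ xs.map ψ, x ∈ (IsLocalRing.maximalIdeal A : Set A) := by
      intro x hx
      obtain ⟨y, hy, rfl⟩ := List.mem_map.1 hx
      exact h.mem y (mem_irrelevant_of_isHomogeneous (h1 y hy) one_pos)
    have h6 := localLike_maximalIdeal.not_hasSocle_of_length_lt avoids_maximalIdeal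
      (Set.mem_univ _) h5 hys (by simp; omega) h4 hy
    have h7 : ¬ HasSocle (irrelevant k n) (I ⊔ Ideal.ofList xs) := by
      intro hs
      have := h.hasSocle (isHomogeneousIdeal_ofList (fun x hx => ⟨1, h1 x hx⟩) hI) le_sup_left hs
      rw [Ideal.map_sup, hψ, Ideal.map_ofList] at this
      exact h6 this
    obtain ⟨z, hz, hzr, -⟩ := avoids_linearForms.exists_regMod h7 h7
    exact ⟨xs ++ [z], by simpa [or_imp, forall_and] using ⟨h1, hz⟩, by simp [h2],
      regSeq_concat.2 ⟨h3, hzr⟩⟩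

end IsLocalQuotientMap

theorem isLocalQuotientMap_localization {I : Ideal (MvPolynomial (Fin n) k)}
    (P : Ideal (MvPolynomial (Fin n) k ⧸ I)) [P.IsPrime]
    (hP : P.comap (Ideal.Quotient.mk I) = irrelevant k n) :
    IsLocalQuotientMap (A := Localization.AtPrime P) I
      ((algebraMap (MvPolynomial (Fin n) k ⧸ I) (Localization.AtPrime P)).comp
      (Ideal.Quotient.mk I)) where
  isUnit r hr := IsLocalization.map_units (M := P.primeCompl) _
    ⟨Ideal.Quotient.mk I r, fun h => hr (hP ▸ h)⟩
  mem r hr := by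
    have : Ideal.Quotient.mk I r ∈ P := by rwa [← hP] at hr
    rw [RingHom.comp_apply]
    exact (IsLocalization.AtPrime.to_map_mem_maximal_iff _ P _).2 this
  exists_mul_eq a := by
    obtain ⟨⟨b, s⟩, hs⟩ := IsLocalization.surj P.primeCompl a
    obtain ⟨b, rfl⟩ := Ideal.Quotient.mk_surjective b
    obtain ⟨r, hr⟩ := Ideal.Quotient.mk_surjective s.1
    refine ⟨r, fun hrm => s.2 ?_, b, ?_⟩
    · rw [← hr]
      rwa [← hP] at hrm
    · rw [mul_comm]
      simpa [hr] using hs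
  exists_mem J hIJ b hb := by
    rw [← Ideal.map_map, RingHom.comp_apply,
      IsLocalization.mem_map_algebraMap_iff P.primeCompl] at hb
    obtain ⟨⟨⟨a, ha⟩, s⟩, hs⟩ := hb
    rw [← map_mul, IsLocalization.eq_iff_exists P.primeCompl] at hs
    obtain ⟨t, ht⟩ := hs
    obtain ⟨r, hr⟩ := Ideal.Quotient.mk_surjective (t * s : P.primeCompl).1
    refine ⟨r, fun hrm => (t * s : P.primeCompl).2 ?_, ?_⟩
    · rw [← hr]
      rwa [← hP] at hrm
    · have h1 : Ideal.Quotient.mk I (r * b) ∈ J.map (Ideal.Quotient.mk I) := by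
        rw [map_mul, hr, Submonoid.coe_mul, mul_assoc, mul_comm s.1, ht]
        exact Ideal.mul_mem_left _ _ ha
      have h2 : r * b ∈ (J.map (Ideal.Quotient.mk I)).comap (Ideal.Quotient.mk I) := h1
      rw [Ideal.comap_map_of_surjective' _ Ideal.Quotient.mk_surjective, Ideal.mk_ker,
        sup_eq_left.2 hIJ] at h2
      exact h2

/-- The dimension at the origin of the residue ring modulo an ideal of height `c` that contains a
complete intersection of this height. -/
theorem le_height_map_irrelevant [Infinite k] {I : Ideal (MvPolynomial (Fin n) k)} {c : ℕ}
    (hht : I.height = c) {e : Fin c → ℕ} {L : Ideal (MvPolynomial (Fin n) k)}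
    (hL : IsCompleteIntersection e L) (hLI : L ≤ I) :
    ((n - c : ℕ) : ℕ∞) ≤ ((irrelevant k n).map (Ideal.Quotient.mk I)).height := by
  -- A prime `P ⊇ I` of height `c` is minimal over `L`, hence associated to it. Ascending from `P`
  -- along `n - c` linear forms regular modulo `L` gives a chain of primes over `I`, whose heights
  -- are measured in `S/I`.
  obtain ⟨P, hP, hIP, hPht⟩ := Ideal.exists_isPrime_height_eq hht
  have hass : IsAss L P := isAss_of_mem_minimalPrimes
    (Ideal.mem_minimalPrimes_of_height_le (hLI.trans hIP) (by rw [hPht]; exact hL.le_height le_rfl))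
  obtain ⟨ys, hys, hlen, hy⟩ := hL.hasLinearRegSeq
  have := localLike_positiveForms.height_like_add_length_le
    (fun Q => (Q.map (Ideal.Quotient.mk I)).height) (I := I) ?_ hL.isHomogeneousIdeal
    (fun y hy => linearForms_subset (hys y hy)) hy hass hIP
  · rw [hlen] at this
    exact le_add_self.trans this
  · intro P Q hP hQ hIP hPQ
    have h1 : (P.map (Ideal.Quotient.mk I)).IsPrime :=
      Ideal.map_isPrime_of_surjective Ideal.Quotient.mk_surjective (by rwa [Ideal.mk_ker])
    have h2 : (Q.map (Ideal.Quotient.mk I)).IsPrime :=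
      Ideal.map_isPrime_of_surjective Ideal.Quotient.mk_surjective
        (by rw [Ideal.mk_ker]; exact hIP.trans hPQ.le)
    refine Ideal.height_add_one_le_of_lt_of_isPrime (lt_of_le_of_ne (Ideal.map_mono hPQ.le) ?_)
    intro heq
    have := congrArg (Ideal.comap (Ideal.Quotient.mk I)) heq
    rw [Ideal.comap_map_of_surjective' _ Ideal.Quotient.mk_surjective,
      Ideal.comap_map_of_surjective' _ Ideal.Quotient.mk_surjective, Ideal.mk_ker,
      sup_eq_left.2 hIP, sup_eq_left.2 (hIP.trans hPQ.le)] at this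
    exact hPQ.ne this

theorem IsCohenMacaulay.hasLinearRegSeq [Infinite k] {I : Ideal (MvPolynomial (Fin n) k)}
    (hCM : IsCohenMacaulay (MvPolynomial (Fin n) k ⧸ I)) (hI : IsHomogeneousIdeal I)
    (hne : I ≠ ⊤) {c : ℕ} (hht : I.height = c) {e : Fin c → ℕ}
    {L : Ideal (MvPolynomial (Fin n) k)} (hL : IsCompleteIntersection e L) (hLI : L ≤ I) :
    HasLinearRegSeq (n - c) I := by
  have hle := hI.le_irrelevant hne
  have hcomap : ((irrelevant k n).map (Ideal.Quotient.mk I)).comap (Ideal.Quotient.mk I) =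
      irrelevant k n := by
    rw [Ideal.comap_map_of_surjective' _ Ideal.Quotient.mk_surjective, Ideal.mk_ker,
      sup_eq_left.2 hle]
  have hmax : ((irrelevant k n).map (Ideal.Quotient.mk I)).IsMaximal := by
    refine (Ideal.map_eq_top_or_isMaximal_of_surjective _ Ideal.Quotient.mk_surjective
      (inferInstanceAs (irrelevant k n).IsMaximal)).resolve_left fun htop => ?_
    rw [htop, Ideal.comap_top] at hcomap
    exact ne_top_of_le_irrelevant le_rfl hcomap.symm
  have hψ := isLocalQuotientMap_localization _ hcomap
  obtain ⟨ys, hy, hlen⟩ := hCM ((irrelevant k n).map (Ideal.Quotient.mk I))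
  refine hψ.hasLinearRegSeq hI ?_ (ys := ys) (fun y hy' => ?_)
    (isWeaklyRegular_iff_regSeq.1 hy.toIsWeaklyRegular) ?_
  · rw [← Ideal.map_map, Ideal.map_quotient_self, Ideal.map_bot]
  · rw [IsLocalRing.mem_maximalIdeal, mem_nonunits_iff]
    intro hu
    refine hy.top_ne_smul ?_
    rw [smul_eq_mul, Ideal.mul_top, eq_comm]
    exact Ideal.eq_top_of_isUnit_mem _ (Ideal.subset_span hy') hu
  · rw [IsLocalization.AtPrime.ringKrullDim_eq_height
      ((irrelevant k n).map (Ideal.Quotient.mk I))] at hlen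
    have h1 := le_height_map_irrelevant hht hL hLI
    have h2 : ((ys.length : ℕ∞) : WithBot ℕ∞) =
      (((irrelevant k n).map (Ideal.Quotient.mk I)).height : WithBot ℕ∞) := hlen
    rw [WithBot.coe_inj] at h2
    rw [← h2] at h1
    exact_mod_cast h1

end CohenMacaulay

end HomLinkage

namespace HomLinkage

/-! ### Linkage, generator degrees and types of complete intersections. -/

section Linkage

open MvPolynomial

variable {k : Type*} [Field k] {n : ℕ}

/-- A bound for the degrees of the forms that do not lie in an ideal of height `n` generated by
forms of degrees `e_1, …, e_c` and by linear forms. -/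
def degreeBound (n : ℕ) {c : ℕ} (e : Fin c → ℕ) : ℕ := 1 + n * (2 * (1 + ∑ i, e i))

theorem IsCompleteIntersection.artinian [Infinite k] {c : ℕ} {e : Fin c → ℕ}
    {L : Ideal (MvPolynomial (Fin n) k)} (hL : IsCompleteIntersection e L)
    {zs : List (MvPolynomial (Fin n) k)} (hzs : ∀ z ∈ zs, z ∈ linearForms k n)
    (hlen : zs.length = n - c) (hz : RegSeq L zs) :
    SimpleSocle (L ⊔ Ideal.ofList zs) ∧
      ContainsFormsFrom (degreeBound n e) (L ⊔ Ideal.ofList zs) := by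
  have hc := hL.length_le
  obtain ⟨he, f, hf, hreg, rfl⟩ := isCompleteIntersection_iff.1 hL
  rw [← ofList_ofFn, ← bot_sup_eq (Ideal.ofList _)] at hz
  have h1 := regSeq_append.2 ⟨hreg, hz⟩
  have h2 : Ideal.span (Set.range f) ⊔ Ideal.ofList zs =
      ⊥ ⊔ Ideal.ofList (List.ofFn f ++ zs) := by
    rw [Ideal.ofList_append, ofList_ofFn, bot_sup_eq]
  have h3 : (List.ofFn f ++ zs).length = n := by simp; omega
  rw [h2]
  refine ⟨simpleSocle_of_regSeq ?_ h3 h1, containsFormsFrom_of_regSeq (by omega) ?_ h3 h1⟩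
  · intro x hx
    rcases List.mem_append.1 hx with hx | hx
    · exact mem_positiveForms_of_mem_ofFn hf he x hx
    · exact linearForms_subset (hzs x hx)
  · intro x hx
    rcases List.mem_append.1 hx with hx | hx
    · obtain ⟨i, rfl⟩ := List.mem_ofFn.1 hx
      have := Finset.single_le_sum (f := e) (fun _ _ => Nat.zero_le _) (Finset.mem_univ i)
      exact ⟨e i, he i, by omega, hf i⟩
    · exact ⟨1, one_pos, by omega, hzs x hx⟩

theorem IsCompleteIntersection.exists_common_regSeq [Infinite k] {c : ℕ} {e : Fin c → ℕ}
    {L J : Ideal (MvPolynomial (Fin n) k)} (hL : IsCompleteIntersection e L)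
    (hJ : IsHomogeneousIdeal J) (hreg : HasLinearRegSeq (n - c) J) :
    ∃ zs : List (MvPolynomial (Fin n) k), (∀ z ∈ zs, z ∈ linearForms k n) ∧
      zs.length = n - c ∧ RegSeq L zs ∧ RegSeq J zs := by
  obtain ⟨xs, hxs, hlen, hx⟩ := hL.hasLinearRegSeq
  obtain ⟨ys, hys, hlen', hy⟩ := hreg
  obtain ⟨zs, h1, h2, h3, h4⟩ := localLike_positiveForms.exists_common_regSeq avoids_positiveForms
    linearForms_subset avoids_linearForms hL.isHomogeneousIdeal hJ
    (fun x h => linearForms_subset (hxs x h)) (fun y h => linearForms_subset (hys y h))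
    (hlen.trans hlen'.symm) hx hy
  exact ⟨zs, h1, h2.trans hlen, h3, h4⟩

/-- Linkage preserves the Cohen-Macaulay property. -/
theorem IsCompleteIntersection.link [Infinite k] {c : ℕ} {e : Fin c → ℕ}
    {L J : Ideal (MvPolynomial (Fin n) k)} (hL : IsCompleteIntersection e L)
    (hJ : IsHomogeneousIdeal J) (hLJ : L ≤ J) (hreg : HasLinearRegSeq (n - c) J) :
    MultiplicationsOnly L J ∧
      HasLinearRegSeq (n - c) (Submodule.colon L (J : Set (MvPolynomial (Fin n) k))) := by
  obtain ⟨zs, h1, h2, h3, h4⟩ := hL.exists_common_regSeq hJ hreg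
  obtain ⟨h5, h6⟩ := hL.artinian h1 h2 h3
  obtain ⟨h7, h8⟩ := multiplicationsOnly_and_regSeq_colon (fun z h => linearForms_subset (h1 z h))
    hL.isHomogeneousIdeal hJ hLJ h5 h6 h3 h4
  exact ⟨h7, zs, h1, h2, h8⟩

/-- A regularity bound: `J` needs no generators in degrees above `s`. With no `z` left this is
clear, since all large forms lie in `J`. To lift through `z`, write `f = ∑ X_i (j_i + z b_i)`; then
`z ∑ X_i b_i` lies in `J`, so `∑ X_i b_i` does. -/
theorem exists_eq_sum_X_mul_mem {zs : List (MvPolynomial (Fin n) k)}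
    (hzs : ∀ z ∈ zs, z ∈ linearForms k n) {J : Ideal (MvPolynomial (Fin n) k)}
    (hJ : IsHomogeneousIdeal J) (hz : RegSeq J zs) {s : ℕ} (hs : 1 ≤ s)
    (hc : ContainsFormsFrom s (J ⊔ Ideal.ofList zs)) {t : ℕ} (ht : s ≤ t)
    {f : MvPolynomial (Fin n) k} (hfJ : f ∈ J) (hf : f.IsHomogeneous (t + 1)) :
    ∃ a : Fin n → MvPolynomial (Fin n) k, (∀ i, a i ∈ J ∧ (a i).IsHomogeneous t) ∧
      f = ∑ i, X i * a i := by
  induction zs generalizing J f with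
  | nil =>
    rw [Ideal.ofList_nil, sup_bot_eq] at hc
    obtain ⟨a, ha, rfl⟩ := exists_eq_sum_X_mul hf
    exact ⟨a, fun i => ⟨hc t ht _ (ha i), ha i⟩, rfl⟩
  | cons z zs ih =>
    rw [sup_ofList_cons] at hc
    have hz1 : z.IsHomogeneous 1 := hzs z (by simp)
    obtain ⟨a, ha, hfa⟩ := ih (fun y hy => hzs y (by simp [hy])) (hJ.sup_span_singleton hz1) hz.2
      hc (Ideal.mem_sup_left hfJ) hf
    obtain ⟨t, rfl⟩ : ∃ t', t = 1 + t' := ⟨t - 1, by omega⟩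
    choose j hj hjt b hb hab using fun i => hJ.exists_decomposition hz1 (ha i).2 (ha i).1
    -- Writing `z = ∑ X_i l_i` with constants `l_i` distributes the remaining term `z ∑ X_i b_i`
    -- over the variables, with coefficients in `J`.
    obtain ⟨l, hl, hzl⟩ := exists_eq_sum_X_mul (t := 0) hz1
    have hβ : ∑ i, X i * b i ∈ J := by
      refine hz.1 _ ?_
      have h1 : z * ∑ i, X i * b i = f - ∑ i, X i * j i := by
        rw [hfa, Finset.mul_sum, ← Finset.sum_sub_distrib]
        refine Finset.sum_congr rfl fun i _ => ?_
        rw [hab i]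
        ring
      rw [h1]
      exact J.sub_mem hfJ (sum_mem fun i _ => J.mul_mem_left _ (hj i))
    have hβt : (∑ i, X i * b i).IsHomogeneous (1 + t) :=
      IsHomogeneous.sum _ _ _ fun i _ => (isHomogeneous_X k i).mul (hb i)
    refine ⟨fun i => j i + l i * ∑ i, X i * b i, fun i => ⟨J.add_mem (hj i) (J.mul_mem_left _ hβ),
      (hjt i).add ?_⟩, ?_⟩
    · have := (hl i).mul hβt
      rwa [zero_add] at this
    · have h2 : f = ∑ i, X i * j i + z * ∑ i, X i * b i := by
        rw [hfa, Finset.mul_sum, ← Finset.sum_add_distrib]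
        refine Finset.sum_congr rfl fun i _ => ?_
        rw [hab i]
        ring
      rw [h2]
      conv_lhs => rw [hzl]
      rw [Finset.sum_mul, ← Finset.sum_add_distrib]
      exact Finset.sum_congr rfl fun i _ => by ring

/-- If `P` contained the degree `D` forms of `J`, it would contain all those of higher degree, by
the regularity bound. Every form of `J` reaches these degrees after multiplication by a power of a
variable outside `P`, so `J ⊆ P`. -/
theorem exists_form_notMem_of_le {zs : List (MvPolynomial (Fin n) k)}
    (hzs : ∀ z ∈ zs, z ∈ linearForms k n) {J : Ideal (MvPolynomial (Fin n) k)}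
    (hJ : IsHomogeneousIdeal J) (hz : RegSeq J zs) {s : ℕ} (hs : 1 ≤ s)
    (hc : ContainsFormsFrom s (J ⊔ Ideal.ofList zs)) {D : ℕ} (hD : s ≤ D)
    {P : Ideal (MvPolynomial (Fin n) k)} [hP : P.IsPrime] (hm : ¬ irrelevant k n ≤ P)
    (hJP : ¬ J ≤ P) : ∃ f ∈ J, f.IsHomogeneous D ∧ f ∉ P := by
  by_contra! hcon
  obtain ⟨i, hi⟩ := exists_X_notMem hm
  have key : ∀ t, ∀ f ∈ J, f.IsHomogeneous (D + t) → f ∈ P := by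
    intro t
    induction t with
    | zero => exact hcon
    | succ t ih =>
      intro f hfJ hf
      obtain ⟨a, ha, rfl⟩ := exists_eq_sum_X_mul_mem hzs hJ hz hs hc (t := D + t) (by omega) hfJ hf
      exact sum_mem fun i _ => P.mul_mem_left _ (ih _ (ha i).1 (ha i).2)
  refine hJP fun f hf => mem_of_homogeneousComponent_mem fun t => ?_
  have h1 := isHomogeneousIdeal_iff.1 hJ f hf t
  have h2 := ((isHomogeneous_X k i).pow D).mul (homogeneousComponent_isHomogeneous t f)
  rw [one_mul] at h2
  exact (hP.mem_or_mem (key t _ (J.mul_mem_left _ h1) h2)).resolve_left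
    fun h => hi (hP.mem_of_pow_mem D h)

theorem eventually_exists_form_notMem {J : Ideal (MvPolynomial (Fin n) k)}
    (hJ : IsHomogeneousIdeal J) {P : Ideal (MvPolynomial (Fin n) k)} (hP : P.IsPrime)
    (hm : ¬ irrelevant k n ≤ P) (hJP : ¬ J ≤ P) :
    ∀ᶠ E in Filter.atTop, ∃ f ∈ J, f.IsHomogeneous E ∧ f ∉ P := by
  obtain ⟨i, hi⟩ := exists_X_notMem hm
  obtain ⟨t, ht⟩ : ∃ t, ∃ f ∈ J, f.IsHomogeneous t ∧ f ∉ P := by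
    by_contra! hcon
    exact hJP fun f hf => mem_of_homogeneousComponent_mem fun t =>
      hcon t _ (isHomogeneousIdeal_iff.1 hJ f hf t) (homogeneousComponent_isHomogeneous t f)
  obtain ⟨f, hfJ, hf, hfP⟩ := ht
  filter_upwards [Filter.eventually_ge_atTop t] with E hE
  obtain ⟨s, rfl⟩ := Nat.exists_eq_add_of_le' hE
  refine ⟨X i ^ s * f, J.mul_mem_left _ hfJ, ?_, fun h => ?_⟩
  · simpa using ((isHomogeneous_X k i).pow s).mul hf
  · exact (hP.mem_or_mem h).elim (fun h => hi (hP.mem_of_pow_mem s h)) hfP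

theorem ofFn_snoc {α : Type*} {m : ℕ} (f : Fin m → α) (x : α) :
    List.ofFn (Fin.snoc (α := fun _ => α) f x) = List.ofFn f ++ [x] := by
  rw [List.ofFn_succ', List.concat_eq_append]
  simp

theorem monotone_snoc {m : ℕ} {e : Fin m → ℕ} {a : ℕ} (he : Monotone e) (ha : ∀ i, e i ≤ a) :
    Monotone (Fin.snoc (α := fun _ => ℕ) e a) := by
  intro i j hij
  induction j using Fin.lastCases with
  | last =>
    induction i using Fin.lastCases with
    | last => exact le_rfl
    | cast i => simpa using ha i
  | cast j =>
    induction i using Fin.lastCases with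
    | last => exact absurd hij (not_le.2 (Fin.castSucc_lt_last j))
    | cast i => simpa using he (by simpa using hij)

theorem isHomogeneous_snoc {m : ℕ} {e : Fin m → ℕ} {a : ℕ} {f : Fin m → MvPolynomial (Fin n) k}
    {x : MvPolynomial (Fin n) k} (hf : ∀ i, (f i).IsHomogeneous (e i)) (hx : x.IsHomogeneous a)
    (i : Fin (m + 1)) : (Fin.snoc (α := fun _ => MvPolynomial (Fin n) k) f x i).IsHomogeneous
      (Fin.snoc (α := fun _ => ℕ) e a i) := by
  induction i using Fin.lastCases with
  | last => simpa using hx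
  | cast i => simpa using hf i

theorem IsCompleteIntersection.snoc {c : ℕ} {e : Fin c → ℕ} {L : Ideal (MvPolynomial (Fin n) k)}
    (hL : IsCompleteIntersection e L) {x : MvPolynomial (Fin n) k} {D : ℕ} (hD : 0 < D)
    (hx : x.IsHomogeneous D) (hxL : RegMod L x) :
    IsCompleteIntersection (Fin.snoc (α := fun _ => ℕ) e D) (L ⊔ Ideal.span {x}) := by
  obtain ⟨he, f, hf, hreg, rfl⟩ := isCompleteIntersection_iff.1 hL
  refine isCompleteIntersection_iff.2 ⟨fun i => ?_, Fin.snoc (α := fun _ => _) f x,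
    isHomogeneous_snoc hf hx, ?_, ?_⟩
  · induction i using Fin.lastCases with
    | last => simpa using hD
    | cast i => simpa using he i
  · rw [ofFn_snoc, regSeq_concat, ofList_ofFn, bot_sup_eq]
    exact ⟨hreg, hxL⟩
  · rw [← ofList_ofFn, ← ofList_ofFn, ofFn_snoc, Ideal.ofList_append, Ideal.ofList_singleton]

theorem regSeq_prefix {R : Type*} [CommRing R] {m N : ℕ} (h : m ≤ N) {f : Fin N → R}
    (hf : RegSeq ⊥ (List.ofFn f)) : RegSeq ⊥ (List.ofFn fun i : Fin m => f (Fin.castLE h i)) := by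
  obtain ⟨j, rfl⟩ := Nat.exists_eq_add_of_le h
  rw [List.ofFn_add] at hf
  exact (regSeq_append.1 hf).1

theorem IsCompleteIntersection.comp_perm {c : ℕ} {e : Fin c → ℕ}
    {L : Ideal (MvPolynomial (Fin n) k)} (hL : IsCompleteIntersection e L)
    (σ : Equiv.Perm (Fin c)) : IsCompleteIntersection (e ∘ σ) L := by
  obtain ⟨he, f, hf, hreg, rfl⟩ := isCompleteIntersection_iff.1 hL
  refine isCompleteIntersection_iff.2 ⟨fun i => he _, f ∘ σ, fun i => hf _, ?_, ?_⟩
  · exact localLike_positiveForms.regSeq_perm isHomogeneousIdeal_bot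
      (Equiv.Perm.ofFn_comp_perm σ f).symm (mem_positiveForms_of_mem_ofFn hf he) hreg
  · rw [σ.surjective.range_comp]

theorem mem_span_of_lt_degree {N : ℕ} {e : Fin N → ℕ} (he : Monotone e)
    {f : Fin N → MvPolynomial (Fin n) k} (hf : ∀ i, (f i).IsHomogeneous (e i))
    {x : MvPolynomial (Fin n) k} {t : ℕ} (hx : x.IsHomogeneous t)
    (hmem : x ∈ Ideal.span (Set.range f)) {i : Fin N} (hi : t < e i) :
    x ∈ Ideal.span (Set.range fun j : Fin i => f (Fin.castLE i.2.le j)) := by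
  obtain ⟨a, rfl⟩ := Ideal.mem_span_range_iff_exists_fun.1 hmem
  rw [← homogeneousComponent_eq_self hx, map_sum]
  refine sum_mem fun j _ => ?_
  rw [mul_comm]
  rcases lt_or_ge j i with hj | hj
  · rcases lt_or_ge t (e j) with ht | ht
    · rw [homogeneousComponent_mul_of_lt (hf j) ht]
      exact zero_mem _
    · obtain ⟨s, rfl⟩ := Nat.exists_eq_add_of_le ht
      rw [homogeneousComponent_add_mul (hf j)]
      exact Ideal.mul_mem_right _ _ (Ideal.subset_span ⟨⟨j, hj⟩, rfl⟩)
  · rw [homogeneousComponent_mul_of_lt (hf j) (hi.trans_le (he hj))]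
    exact zero_mem _

/-- The type of a complete intersection is bounded by those of complete intersections in it. -/
theorem IsCompleteIntersection.type_le {N : ℕ} {e δ : Fin N → ℕ}
    {K L : Ideal (MvPolynomial (Fin n) k)} (hK : IsCompleteIntersection e K)
    (hL : IsCompleteIntersection δ L) (hLK : L ≤ K) (he : Monotone e) (hδ : Monotone δ)
    (i : Fin N) : e i ≤ δ i := by
  obtain ⟨hepos, f, hf, -, rfl⟩ := isCompleteIntersection_iff.1 hK
  obtain ⟨-, g, hg, hreg, rfl⟩ := isCompleteIntersection_iff.1 hL
  by_contra! hlt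
  have h1 := regSeq_prefix (Nat.succ_le_of_lt i.2) hreg
  -- By degree, the first `i + 1` generators of `L` lie in the ideal of the first `i` generators of
  -- `K`, whose height is at most `i`.
  have h2 := length_le_height h1 (I := Ideal.span (Set.range fun j : Fin i =>
    f (Fin.castLE i.2.le j))) (by
      rw [ofList_ofFn, bot_sup_eq, Ideal.span_le]
      rintro _ ⟨j, rfl⟩
      refine mem_span_of_lt_degree he hf (hg _) (hLK (Ideal.subset_span ⟨_, rfl⟩))
        (lt_of_le_of_lt (hδ ?_) hlt)
      have := j.2
      simp only [Fin.le_def, Fin.val_castLE]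
      omega)
  have h3 := h2.trans (height_span_range_le _ (ne_top_of_le_irrelevant
    (span_range_le_irrelevant (fun j => hf _) (fun j => hepos _))))
  rw [List.length_ofFn] at h3
  have h4 : (i : ℕ) + 1 ≤ i := by exact_mod_cast h3
  omega

/-- A regular sequence of forms in a homogeneous ideal of larger height can be extended by a form
of arbitrarily large degree. -/
theorem exists_form_regMod_mem [Infinite k] {I : Ideal (MvPolynomial (Fin n) k)} {c : ℕ}
    (hI : IsHomogeneousIdeal I) (hne : I ≠ ⊤) (hht : I.height = c)
    {xs : List (MvPolynomial (Fin n) k)} (hxs : ∀ x ∈ xs, x ∈ positiveForms k n)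
    (hx : RegSeq ⊥ xs) (hlt : xs.length < c) (E₀ : ℕ) :
    ∃ E, E₀ ≤ E ∧ ∃ z ∈ I, z.IsHomogeneous E ∧ RegMod (⊥ ⊔ Ideal.ofList xs) z := by
  have hle := hI.le_irrelevant hne
  have hcn : c ≤ n := by
    have := (Ideal.height_mono hle).trans height_irrelevant_le
    rw [hht] at this
    exact_mod_cast this
  have hJ : IsHomogeneousIdeal (⊥ ⊔ Ideal.ofList xs) :=
    isHomogeneousIdeal_ofList (fun x hx => let ⟨e, _, h⟩ := hxs x hx; ⟨e, h⟩) isHomogeneousIdeal_bot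
  have hreg := hasLinearRegSeq_of_regSeq hxs hx (by omega)
  -- By unmixedness these primes have height at most the length of `xs`, which is less than the
  -- height of `I`.
  have hIP : ∀ P, IsAss (⊥ ⊔ Ideal.ofList xs) P → ¬ I ≤ P := by
    intro P hP hIP
    have h1 := (add_le_add_left (Ideal.height_mono hIP) _).trans (hreg.height_add_le hJ hP)
    rw [hht] at h1
    have h2 : c + (n - xs.length) ≤ n := by exact_mod_cast h1
    omega
  obtain ⟨E, hE, hE₀⟩ := (((Filter.eventually_all_finite (finite_isAss (⊥ ⊔ Ideal.ofList xs))).2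
    fun P hP => eventually_exists_form_notMem hI hP.1 (fun h => hIP P hP (hle.trans h))
      (hIP P hP)).and (Filter.eventually_ge_atTop E₀)).exists
  obtain ⟨z, hz, hzP⟩ := exists_mem_forall_notMem_ideal
    (I.restrictScalars k ⊓ homogeneousSubmodule (Fin n) k E) (finite_isAss (⊥ ⊔ Ideal.ofList xs))
    (fun P hP => by
      obtain ⟨f, hf, hfE, hfP⟩ := hE P hP
      exact ⟨f, ⟨hf, hfE⟩, hfP⟩)
  exact ⟨E, hE₀, z, hz.1, hz.2, regMod_of_notMem_isAss hzP⟩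

/-- A regular sequence of forms in a homogeneous ideal of height `c` extends to one of length
`c`. -/
theorem exists_isCompleteIntersection_extension [Infinite k] {I : Ideal (MvPolynomial (Fin n) k)}
    {c : ℕ} (hI : IsHomogeneousIdeal I) (hne : I ≠ ⊤) (hht : I.height = c) {m : ℕ} (hm : m ≤ c)
    {e : Fin m → ℕ} (he : Monotone e) {L : Ideal (MvPolynomial (Fin n) k)}
    (hL : IsCompleteIntersection e L) (hLI : L ≤ I) :
    ∃ (e' : Fin c → ℕ) (L' : Ideal (MvPolynomial (Fin n) k)), Monotone e' ∧
      IsCompleteIntersection e' L' ∧ L' ≤ I ∧ ∀ i : Fin m, e' (Fin.castLE hm i) = e i := by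
  obtain ⟨j, rfl⟩ := Nat.exists_eq_add_of_le hm
  induction j generalizing m L with
  | zero => exact ⟨e, L, he, hL, hLI, fun i => rfl⟩
  | succ j ih =>
    obtain ⟨hpos, f, hf, hreg, rfl⟩ := isCompleteIntersection_iff.1 hL
    -- The threshold `1 + ∑ e_i` makes the new degree positive and keeps the type nondecreasing.
    obtain ⟨E, hE, z, hzI, hz, hzr⟩ := exists_form_regMod_mem hI hne hht
      (mem_positiveForms_of_mem_ofFn hf hpos) hreg (by simp) (1 + ∑ i, e i)
    rw [ofList_ofFn, bot_sup_eq] at hzr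
    have hle : ∀ i, e i ≤ E := fun i => by
      have := Finset.single_le_sum (f := e) (fun _ _ => Nat.zero_le _) (Finset.mem_univ i)
      omega
    obtain ⟨e', L', h1, h2, h3, h4⟩ := ih (m := m + 1) (hm := by omega) (monotone_snoc he hle)
      (hL.snoc (by omega) hz hzr)
      (sup_le hLI ((Ideal.span_singleton_le_iff_mem I).2 hzI)) (hht := by rw [hht]; congr 1; ring)
    have hcast : m + 1 + j = m + (j + 1) := by ring
    refine ⟨fun i => e' (Fin.cast hcast.symm i), L', fun a b hab => h1 (by simpa using hab), ?_, h3,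
      fun i => ?_⟩
    · obtain ⟨g1, g, g2, g3, g4⟩ := isCompleteIntersection_iff.1 h2
      refine isCompleteIntersection_iff.2 ⟨fun i => g1 _, fun i => g (Fin.cast hcast.symm i),
        fun i => g2 _, ?_, ?_⟩
      · rwa [List.ofFn_congr hcast] at g3
      · rw [g4]
        congr 1
        exact ((finCongr hcast.symm).surjective.range_comp g).symm
    · have := h4 (Fin.castSucc i)
      rw [Fin.snoc_castSucc] at this
      rw [← this]
      rfl

end Linkage

end HomLinkage

namespace HomLinkage

/-! ### Conditions on a general form. -/

section GeneralForms

open MvPolynomial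

variable {k : Type*} [Field k] {n : ℕ}

theorem HoldsForGeneralForm.mono {D : ℕ} {Q Q' : MvPolynomial (Fin n) k → Prop}
    (h : HoldsForGeneralForm D Q)
    (hQ : ∀ F : MvPolynomial (Fin n) k, F.IsHomogeneous D → Q F → Q' F) :
    HoldsForGeneralForm D Q' := by
  obtain ⟨P, h1, h2⟩ := h
  exact ⟨P, h1, fun F hF hP => hQ F hF (h2 F hF hP)⟩

theorem holdsForGeneralForm_of_forall {D : ℕ} {Q : MvPolynomial (Fin n) k → Prop}
    (h : ∀ F : MvPolynomial (Fin n) k, F.IsHomogeneous D → Q F) : HoldsForGeneralForm D Q :=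
  ⟨1, ⟨0, isHomogeneous_zero _ _ _, by simp⟩, fun F hF _ => h F hF⟩

/-- On the line through a witness of each condition, both polynomials restrict to nonzero
polynomials in one variable, and an infinite field has a point where neither vanishes. -/
theorem HoldsForGeneralForm.and [Infinite k] {D : ℕ} {Q Q' : MvPolynomial (Fin n) k → Prop}
    (h : HoldsForGeneralForm D Q) (h' : HoldsForGeneralForm D Q') :
    HoldsForGeneralForm D fun F => Q F ∧ Q' F := by
  obtain ⟨P, ⟨F, hF, hPF⟩, hQ⟩ := h
  obtain ⟨P', ⟨F', hF', hPF'⟩, hQ'⟩ := h'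
  refine ⟨P * P', ?_, fun G hG hPG => ?_⟩
  · let g : (Fin n →₀ ℕ) → Polynomial k := fun m =>
      Polynomial.C (coeff m F) + Polynomial.X * Polynomial.C (coeff m (F' - F))
    have hev : ∀ (p : MvPolynomial (Fin n →₀ ℕ) k) (t : k),
        Polynomial.eval t (aeval g p) = eval (fun m => coeff m (F + C t * (F' - F))) p := by
      intro p t
      rw [← Polynomial.coe_aeval_eq_eval, comp_aeval_apply, aeval_eq_eval]
      congr 2
      funext m
      simp [g, coeff_C_mul]
    have h1 : aeval g P ≠ 0 := fun h0 => hPF (by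
      have := hev P 0
      rw [h0] at this
      simpa using this.symm)
    have h2 : aeval g P' ≠ 0 := fun h0 => hPF' (by
      have := hev P' 1
      rw [h0] at this
      simpa using this.symm)
    obtain ⟨t, ht⟩ : ∃ t, Polynomial.eval t (aeval g P * aeval g P') ≠ 0 := by
      by_contra! hcon
      exact mul_ne_zero h1 h2 (Polynomial.funext (by simpa using hcon))
    refine ⟨F + C t * (F' - F), hF.add ?_, ?_⟩
    · simpa using (isHomogeneous_C (Fin n) t).mul (hF'.sub hF)
    · rwa [← map_mul, hev] at ht
  · rw [map_mul] at hPG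
    exact ⟨hQ G hG (left_ne_zero_of_mul hPG), hQ' G hG (right_ne_zero_of_mul hPG)⟩

/-- A functional that vanishes on `U` but not at `F` is, on forms of degree `D`, a linear polynomial
in the coefficients. -/
theorem holdsForGeneralForm_notMem {D : ℕ} {U : Submodule k (MvPolynomial (Fin n) k)}
    {F : MvPolynomial (Fin n) k} (hF : F.IsHomogeneous D) (hFU : F ∉ U) :
    HoldsForGeneralForm D fun F => F ∉ U := by
  obtain ⟨lam, hlam, hker⟩ := Submodule.exists_le_ker_of_notMem hFU
  have hfin : {m : Fin n →₀ ℕ | m.degree ≤ D}.Finite := Finsupp.finite_of_degree_le D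
  have hev : ∀ G : MvPolynomial (Fin n) k, G.IsHomogeneous D →
      eval (fun m => coeff m G) (∑ m ∈ hfin.toFinset, C (lam (monomial m 1)) * X m) = lam G := by
    intro G hG
    have hsub : G.support ⊆ hfin.toFinset := by
      intro m hm
      rw [Set.Finite.mem_toFinset]
      by_contra hmD
      exact (mem_support_iff.1 hm) (hG.coeff_eq_zero fun h => hmD h.le)
    conv_rhs => rw [G.as_sum, map_sum]
    rw [map_sum, ← Finset.sum_subset hsub]
    · refine Finset.sum_congr rfl fun m _ => ?_
      have : monomial m (coeff m G) = coeff m G • monomial m (1 : k) := by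
        rw [smul_monomial, smul_eq_mul, mul_one]
      rw [this, map_smul]
      simp [mul_comm]
    · intro m _ hm
      simp [notMem_support_iff.1 hm]
  refine ⟨_, ⟨F, hF, by rwa [hev F hF]⟩, fun G hG hne hGU => hne ?_⟩
  rw [hev G hG]
  exact hker hGU

theorem holdsForGeneralForm_forall_notMem [Infinite k] {D : ℕ}
    {s : Set (Ideal (MvPolynomial (Fin n) k))} (hs : s.Finite)
    (h : ∀ P ∈ s, P.IsPrime ∧ ¬ irrelevant k n ≤ P) :
    HoldsForGeneralForm D fun F : MvPolynomial (Fin n) k => ∀ P ∈ s, F ∉ P := by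
  induction s, hs using Set.Finite.induction_on with
  | empty => exact holdsForGeneralForm_of_forall (by simp)
  | @insert P s _ _ ih =>
    obtain ⟨hP, hm⟩ := h P (by simp)
    obtain ⟨i, hi⟩ := exists_X_notMem hm
    have h1 := holdsForGeneralForm_notMem (U := P.restrictScalars k)
      (by simpa using (isHomogeneous_X k i).pow D) (fun h => hi (hP.mem_of_pow_mem D h))
    refine (h1.and (ih fun Q hQ => h Q (by simp [hQ]))).mono fun F _ hF => ?_
    simpa using hF

theorem holdsForGeneralForm_regMod [Infinite k] {D : ℕ} {L : Ideal (MvPolynomial (Fin n) k)}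
    (hL : ¬ HasSocle (irrelevant k n) L) :
    HoldsForGeneralForm D fun F : MvPolynomial (Fin n) k => RegMod L F :=
  (holdsForGeneralForm_forall_notMem (finite_isAss L)
    fun _ hP => ⟨hP.1, IsAss.not_le_of_not_hasSocle hP hL⟩).mono
      fun _ _ hF => regMod_of_notMem_isAss hF

end GeneralForms

/-! ### Hypersurface sections of linkage classes. -/

section HypersurfaceSections

open MvPolynomial

variable {k : Type*} [Field k] {n : ℕ}

theorem le_colon {R : Type*} [CommRing R] (L I : Ideal R) : L ≤ Submodule.colon L (I : Set R) := by
  intro x hx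
  rw [Submodule.mem_colon]
  exact fun y _ => L.mul_mem_right y hx

theorem colon_self_eq_top {R : Type*} [CommRing R] (L : Ideal R) :
    Submodule.colon L (L : Set R) = ⊤ := by
  rw [Ideal.eq_top_iff_one, Submodule.mem_colon]
  intro y hy
  simpa using hy

theorem height_sup_span_singleton [Infinite k] {c : ℕ} {I L : Ideal (MvPolynomial (Fin n) k)}
    (hI : IsHomogeneousIdeal I) (hne : I ≠ ⊤) (hc : c < n) (hreg : HasLinearRegSeq (n - c) I)
    {F : MvPolynomial (Fin n) k} {D : ℕ} (hD : 0 < D) (hF : F.IsHomogeneous D) (hFI : RegMod I F)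
    {e : Fin (c + 1) → ℕ} (hL : IsCompleteIntersection e L) (hLI : L ≤ I ⊔ Ideal.span {F}) :
    (I ⊔ Ideal.span {F}).height = (c + 1 : ℕ) := by
  refine le_antisymm ?_ (hL.le_height hLI)
  rw [show n - c = n - (c + 1) + 1 by omega] at hreg
  have h1 := (hreg.sup hI ⟨D, hD, hF⟩ hFI).height_ideal_add_le (hI.sup_span_singleton hF)
    (ne_top_of_le_irrelevant (sup_le (hI.le_irrelevant hne)
      ((Ideal.span_singleton_le_iff_mem _).2 (mem_irrelevant_of_isHomogeneous hF hD))))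
  have h2 : (n : ℕ∞) = ((c + 1 : ℕ) : ℕ∞) + ((n - (c + 1) : ℕ) : ℕ∞) := by
    exact_mod_cast (by omega : n = c + 1 + (n - (c + 1)))
  rw [h2] at h1
  exact (ENat.add_le_add_iff_right (ENat.natCast_ne_top _)).1 h1

theorem sup_span_singleton_ne_top {I : Ideal (MvPolynomial (Fin n) k)}
    (hI : IsHomogeneousIdeal I) (hne : I ≠ ⊤) {F : MvPolynomial (Fin n) k} {D : ℕ} (hD : 0 < D)
    (hF : F.IsHomogeneous D) : I ⊔ Ideal.span {F} ≠ ⊤ :=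
  ne_top_of_le_irrelevant (sup_le (hI.le_irrelevant hne)
    ((Ideal.span_singleton_le_iff_mem _).2 (mem_irrelevant_of_isHomogeneous hF hD)))

/-- Licci ideals are Cohen-Macaulay: the property holds for `K` and passes back along each link. -/
theorem hasLinearRegSeq_of_reflTransGen [Infinite k] {c : ℕ} {I K : Ideal (MvPolynomial (Fin n) k)}
    (h : Relation.ReflTransGen (DirectlyLinked c) I K) {e : Fin c → ℕ}
    (hK : IsCompleteIntersection e K) : HasLinearRegSeq (n - c) I := by
  induction h using Relation.ReflTransGen.head_induction_on with
  | refl => exact hK.hasLinearRegSeq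
  | @head I J hIJ _ ih =>
    obtain ⟨e, L, hL, hlink⟩ := hIJ
    have hLJ : L ≤ J := hlink.colon_left ▸ le_colon L I
    rw [← hlink.colon_right]
    exact (hL.link hlink.homogeneous_right hLJ ih).2

/-- A general hypersurface section of a licci ideal is licci. -/
theorem holdsForGeneralForm_reflTransGen [Infinite k] {c D : ℕ} (hD : 0 < D) (hc : c < n)
    {I K : Ideal (MvPolynomial (Fin n) k)}
    (h : Relation.ReflTransGen (DirectlyLinked c) I K) {e : Fin c → ℕ}
    (hK : IsCompleteIntersection e K) :
    HoldsForGeneralForm D fun F : MvPolynomial (Fin n) k =>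
      Relation.ReflTransGen (DirectlyLinked (c + 1)) (I ⊔ Ideal.span {F}) (K ⊔ Ideal.span {F}) ∧
        IsCompleteIntersection (Fin.snoc (α := fun _ => ℕ) e D) (K ⊔ Ideal.span {F}) := by
  have hgen : ∀ {e : Fin c → ℕ} {L : Ideal (MvPolynomial (Fin n) k)}, IsCompleteIntersection e L →
      HoldsForGeneralForm D fun F : MvPolynomial (Fin n) k => RegMod L F := by
    intro e L hL
    have := hL.hasLinearRegSeq
    rw [show n - c = n - (c + 1) + 1 by omega] at this
    exact holdsForGeneralForm_regMod this.not_hasSocle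
  induction h using Relation.ReflTransGen.head_induction_on with
  | refl =>
    exact (hgen hK).mono fun F hF hFK => ⟨.refl, hK.snoc hD hF hFK⟩
  | @head I J hIJ hJK ih =>
    have hregJ := hasLinearRegSeq_of_reflTransGen hJK hK
    have hregI := hasLinearRegSeq_of_reflTransGen (.head hIJ hJK) hK
    obtain ⟨e', L, hL, hlink⟩ := hIJ
    have hLI : L ≤ I := hlink.colon_right ▸ le_colon L J
    have hLJ : L ≤ J := hlink.colon_left ▸ le_colon L I
    refine (ih.and (hgen hL)).mono fun F hF ⟨⟨h1, h2⟩, hFL⟩ => ⟨.head ?_ h1, h2⟩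
    have hLF := hL.snoc hD hF hFL
    -- Both linked ideals are residuals of `L`, so they inherit regularity of `F` from `L`.
    have hIF : RegMod I F := hlink.colon_right ▸ regMod_colon J hFL
    have hJF : RegMod J F := hlink.colon_left ▸ regMod_colon I hFL
    refine ⟨_, L ⊔ Ideal.span {F}, hLF, hlink.homogeneous_left.sup_span_singleton hF,
      hlink.homogeneous_right.sup_span_singleton hF,
      sup_span_singleton_ne_top hlink.homogeneous_left hlink.proper_left hD hF,
      sup_span_singleton_ne_top hlink.homogeneous_right hlink.proper_right hD hF,
      height_sup_span_singleton hlink.homogeneous_left hlink.proper_left hc hregI hD hF hIF hLF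
        (sup_le_sup_right hLI _),
      height_sup_span_singleton hlink.homogeneous_right hlink.proper_right hc hregJ hD hF hJF hLF
        (sup_le_sup_right hLJ _), ?_, ?_⟩
    · rw [(hL.link hlink.homogeneous_left hLI hregI).1.colon_sup hL.isHomogeneousIdeal
        hlink.homogeneous_left hF hFL, hlink.colon_left]
    · rw [(hL.link hlink.homogeneous_right hLJ hregJ).1.colon_sup hL.isHomogeneousIdeal
        hlink.homogeneous_right hF hFL, hlink.colon_right]

/-- A class of Cohen-Macaulay ideals of minimal type `d` that is closed under residuals. -/
structure LinkageClass {c : ℕ} (d : Fin c → ℕ) (C : Set (Ideal (MvPolynomial (Fin n) k))) :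
    Prop where
  homogeneous : ∀ I ∈ C, IsHomogeneousIdeal I
  ne_top : ∀ I ∈ C, I ≠ ⊤
  height : ∀ I ∈ C, I.height = c
  closed : ClosedUnderResiduals d C
  minimal : ∀ I ∈ C, IsMinimalType d I
  regSeq : ∀ I ∈ C, HasLinearRegSeq (n - c) I

/-- For `c = n` a power of `F` would lie in `L ⊆ I`, and regularity of `F` would make `I` the unit
ideal. -/
theorem lt_of_regMod [Infinite k] {c : ℕ} {d : Fin c → ℕ} {I L : Ideal (MvPolynomial (Fin n) k)}
    (hne : I ≠ ⊤) (hL : IsCompleteIntersection d L) (hLI : L ≤ I) {D : ℕ} (hD : 0 < D)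
    {F : MvPolynomial (Fin n) k} (hF : F.IsHomogeneous D) (hFI : RegMod I F) : c < n := by
  refine lt_of_le_of_ne hL.length_le ?_
  rintro rfl
  have h1 := (hL.artinian (zs := []) (by simp) (by simp) trivial).2
  rw [Ideal.ofList_nil, sup_bot_eq] at h1
  have h2 : F ^ degreeBound c d ∈ I :=
    hLI (h1 _ (Nat.le_mul_of_pos_left _ hD) _ (hF.pow _))
  exact hne ((Ideal.eq_top_iff_one I).2 (hFI.pow _ 1 (by simpa using h2)))

namespace LinkageClass

variable {c : ℕ} {d : Fin c → ℕ} {C : Set (Ideal (MvPolynomial (Fin n) k))} {D : ℕ}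

/-- It suffices that for each associated prime `P` of `L` some form of degree `D` in `(I, F)` lies
outside `P`. If `F` itself fails, then `P` does not contain `I`, and the regularity bound supplies a
form of `I`. -/
theorem exists_form_regMod [Infinite k] (h : LinkageClass d C)
    (hbound : degreeBound n d ≤ D) {I L : Ideal (MvPolynomial (Fin n) k)} (hI : I ∈ C)
    (hL : IsCompleteIntersection d L) (hLI : L ≤ I) {F : MvPolynomial (Fin n) k}
    (hF : F.IsHomogeneous D) (hFI : RegMod I F) :
    ∃ w ∈ I ⊔ Ideal.span {F}, w.IsHomogeneous D ∧ RegMod L w := by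
  have hD : 0 < D := lt_of_lt_of_le (by simp [degreeBound]) hbound
  have hc := lt_of_regMod (h.ne_top I hI) hL hLI hD hF hFI
  have hregL := hL.hasLinearRegSeq
  have hsoc : ¬ HasSocle (irrelevant k n) L := by
    rw [show n - c = n - (c + 1) + 1 by omega] at hregL
    exact hregL.not_hasSocle
  obtain ⟨zs, h1, h2, h3, h4⟩ := hL.exists_common_regSeq (h.homogeneous I hI) (h.regSeq I hI)
  have hforms : ContainsFormsFrom (degreeBound n d) (I ⊔ Ideal.ofList zs) := fun t ht f hf =>
    sup_le_sup_right hLI _ ((hL.artinian h1 h2 h3).2 t ht f hf)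
  obtain ⟨w, hw, hwP⟩ := exists_mem_forall_notMem_ideal
    (((I ⊔ Ideal.span {F}).restrictScalars k) ⊓ homogeneousSubmodule (Fin n) k D)
    (finite_isAss L) (by
      intro P hP
      have hPprime := hP.1
      by_cases hFP : F ∈ P
      · have hIP : ¬ I ≤ P := by
          -- If `I ⊆ P`, then `P` has height at most `c`, the height of `I`, so `P` is associated to
          -- `I`; but `F` lies in `P` and is regular modulo `I`.
          intro hIP
          have h5 := hregL.height_add_le hL.isHomogeneousIdeal hP
          have h6 : (n : ℕ∞) = (c : ℕ∞) + ((n - c : ℕ) : ℕ∞) := by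
            exact_mod_cast (by omega : n = c + (n - c))
          rw [h6] at h5
          have h7 := (ENat.add_le_add_iff_right (ENat.natCast_ne_top _)).1 h5
          have h8 := isAss_of_mem_minimalPrimes
            (Ideal.mem_minimalPrimes_of_height_le hIP (by rwa [h.height I hI]))
          exact h8.notMem_of_regMod hFI hFP
        obtain ⟨f, hfI, hf, hfP⟩ := exists_form_notMem_of_le h1 (h.homogeneous I hI) h4
          (by simp [degreeBound]) hforms hbound (hP.not_le_of_not_hasSocle hsoc) hIP
        exact ⟨f, ⟨Ideal.mem_sup_left hfI, hf⟩, hfP⟩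
      · exact ⟨F, ⟨self_mem_sup_span_singleton I F, hF⟩, hFP⟩)
  exact ⟨w, hw.1, hw.2, regMod_of_notMem_isAss hwP⟩

theorem isMinimalType [Infinite k] (h : LinkageClass d C)
    (hbound : degreeBound n d ≤ D) (hdD : ∀ i, d i < D) {K : Ideal (MvPolynomial (Fin n) k)}
    (hK : K ∈ hypersurfaceSections D C) :
    IsMinimalType (Fin.snoc (α := fun _ => ℕ) d D) K := by
  obtain ⟨I, hI, F, hF, hFI, rfl⟩ := hK
  replace hFI := isSMulRegular_quotient_iff.1 hFI
  have hD : 0 < D := lt_of_lt_of_le (by simp [degreeBound]) hbound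
  have hhom := h.homogeneous I hI
  refine ⟨monotone_snoc (h.minimal I hI).monotone fun i => (hdD i).le, ?_, ?_⟩
  · obtain ⟨L, hL, hLI⟩ := (h.minimal I hI).occurs
    obtain ⟨w, hwK, hw, hwL⟩ := h.exists_form_regMod hbound hI hL hLI hF hFI
    exact ⟨_, hL.snoc hD hw hwL, sup_le (hLI.trans le_sup_left)
      ((Ideal.span_singleton_le_iff_mem _).2 hwK)⟩
  · rintro e he ⟨L, hL, hLK⟩ i
    obtain ⟨hpos, g, hg, hreg, rfl⟩ := isCompleteIntersection_iff.1 hL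
    have hgI : ∀ j, e j < D → g j ∈ I := fun j hj =>
      hhom.mem_of_lt hF (hg j) hj (hLK (Ideal.subset_span ⟨j, rfl⟩))
    induction i using Fin.lastCases with
    -- If the largest degree were below `D`, a regular sequence of length `c + 1` would lie in `I`,
    -- which has height `c`.
    | last =>
      rw [Fin.snoc_last]
      by_contra! hlt
      have h1 := hL.le_height (I := I) (by
        rw [Ideal.span_le]
        rintro _ ⟨j, rfl⟩
        exact hgI j ((he (Fin.le_last j)).trans_lt hlt))
      rw [h.height I hI] at h1
      have h2 : c + 1 ≤ c := by exact_mod_cast h1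
      omega
    | cast i =>
      rw [Fin.snoc_castSucc]
      by_contra! hlt
      have hle : (i : ℕ) + 1 ≤ c := i.2
      have hle' : (i : ℕ) + 1 ≤ c + 1 := hle.trans (Nat.le_succ c)
      have hlt' : ∀ j : Fin (i + 1), e (Fin.castLE hle' j) < D := fun j => by
        have h1 : e (Fin.castLE hle' j) ≤ e i.castSucc := he (by
          have := j.2
          simp only [Fin.le_def, Fin.val_castLE, Fin.val_castSucc]
          omega)
        have h2 := hdD i
        omega
      -- The first `i + 1` forms lie in `I`. Completing them to length `c` inside `I` keeps their
      -- degrees, so minimality of `d` for `I` is contradicted at index `i`.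
      have hL' : IsCompleteIntersection (fun j : Fin (i + 1) => e (Fin.castLE hle' j))
          (Ideal.span (Set.range fun j : Fin (i + 1) => g (Fin.castLE hle' j))) :=
        isCompleteIntersection_iff.2 ⟨fun j => hpos _, _, fun j => hg _,
          regSeq_prefix hle' hreg, rfl⟩
      obtain ⟨e', L', h1, h2, h3, h4⟩ := exists_isCompleteIntersection_extension hhom
        (h.ne_top I hI) (h.height I hI) hle
        (fun a b hab => he ((Fin.castLE_le_castLE_iff hle').2 hab)) hL' (by
          rw [Ideal.span_le]
          rintro _ ⟨j, rfl⟩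
          exact hgI _ (hlt' j))
      have h5 := (h.minimal I hI).le e' h1 ⟨L', h2, h3⟩ i
      have h6 := h4 (Fin.last i)
      have h7 : Fin.castLE hle (Fin.last i) = i := rfl
      have h8 : Fin.castLE hle' (Fin.last (i : ℕ)) = i.castSucc := rfl
      rw [h7, h8] at h6
      omega

theorem closedUnderResiduals [Infinite k] (h : LinkageClass d C)
    (hdD : ∀ i, d i < D) :
    ClosedUnderResiduals (Fin.snoc (α := fun _ => ℕ) d D) (hypersurfaceSections D C) := by
  rintro _ ⟨I, hI, F, hF, hFI, rfl⟩ L hL hLK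
  replace hFI := isSMulRegular_quotient_iff.1 hFI
  have hhom := h.homogeneous I hI
  obtain ⟨hpos, g, hg, hreg, rfl⟩ := isCompleteIntersection_iff.1 hL
  obtain ⟨f, z, rfl⟩ : ∃ (f : Fin c → MvPolynomial (Fin n) k) (z : MvPolynomial (Fin n) k),
      g = Fin.snoc (α := fun _ => _) f z :=
    ⟨Fin.init g, g (Fin.last c), (Fin.snoc_init_self g).symm⟩
  have hf : ∀ i, (f i).IsHomogeneous (d i) := fun i => by simpa using hg i.castSucc
  have hz : z.IsHomogeneous D := by simpa using hg (Fin.last c)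
  have hfI : Ideal.span (Set.range f) ≤ I := by
    rw [Ideal.span_le]
    rintro _ ⟨i, rfl⟩
    refine hhom.mem_of_lt hF (hf i) (hdD i) (hLK (Ideal.subset_span ⟨i.castSucc, ?_⟩))
    simp
  have hzK : z ∈ I ⊔ Ideal.span {F} := hLK (Ideal.subset_span ⟨Fin.last c, by simp⟩)
  rw [ofFn_snoc, regSeq_concat, ofList_ofFn, bot_sup_eq] at hreg
  obtain ⟨hreg, hzr⟩ := hreg
  have hLf : IsCompleteIntersection d (Ideal.span (Set.range f)) :=
    isCompleteIntersection_iff.2 ⟨fun i => by simpa using hpos i.castSucc, f, hf, hreg, rfl⟩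
  have hspan : Ideal.span (Set.range (Fin.snoc (α := fun _ => MvPolynomial (Fin n) k) f z)) =
      Ideal.span (Set.range f) ⊔ Ideal.span {z} := by
    rw [← ofList_ofFn, ← ofList_ofFn, ofFn_snoc, Ideal.ofList_append, Ideal.ofList_singleton]
  rw [hspan] at hL ⊢
  -- Since `z` and `F` have the same degree, the cofactor of `F` is a constant `u`. If `u = 0`, the
  -- whole complete intersection, of height `c + 1`, lies in `I`.
  obtain ⟨j, hj, -, b, hb, hzb⟩ := hhom.exists_decomposition (t := 0) hF (by simpa using hz) hzK
  obtain ⟨u, rfl⟩ : ∃ u, b = MvPolynomial.C u :=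
    ⟨_, totalDegree_eq_zero_iff_eq_C.1 (Nat.le_zero.1 hb.totalDegree_le)⟩
  have hu : u ≠ 0 := by
    rintro rfl
    rw [map_zero, mul_zero, add_zero] at hzb
    have h1 := hL.le_height (sup_le hfI ((Ideal.span_singleton_le_iff_mem I).2 (hzb ▸ hj)))
    rw [h.height I hI] at h1
    have h2 : c + 1 ≤ c := by exact_mod_cast h1
    omega
  have hFz : F = MvPolynomial.C u⁻¹ * (z - j) := by
    rw [hzb, add_sub_cancel_left, mul_left_comm, ← MvPolynomial.C_mul, inv_mul_cancel₀ hu,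
      MvPolynomial.C_1, mul_one]
  have hsup : I ⊔ Ideal.span {F} = I ⊔ Ideal.span {z} := by
    refine le_antisymm (sup_le le_sup_left ?_) (sup_le le_sup_left ?_)
    · rw [Ideal.span_singleton_le_iff_mem, hFz]
      exact Ideal.mul_mem_left _ _
        (sub_mem (self_mem_sup_span_singleton I z) (Ideal.mem_sup_left hj))
    · rwa [Ideal.span_singleton_le_iff_mem]
  rw [hsup, (hLf.link hhom hfI (h.regSeq I hI)).1.colon_sup hLf.isHomogeneousIdeal hhom hz hzr]
  exact ⟨_, h.closed I hI _ hLf hfI, z, hz,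
    isSMulRegular_quotient_iff.2 (regMod_colon I hzr), rfl⟩

theorem ne_top_of_mem (h : LinkageClass d C) {K : Ideal (MvPolynomial (Fin n) k)}
    (hD : 0 < D) (hK : K ∈ hypersurfaceSections D C) : K ≠ ⊤ := by
  obtain ⟨I, hI, F, hF, -, rfl⟩ := hK
  exact sup_span_singleton_ne_top (h.homogeneous I hI) (h.ne_top I hI) hD hF

/-- Such a `K` would have type `(d, D)` after sorting, by minimality on one side and `type_le` on
the other. Its residual with respect to itself is the unit ideal, which closure under residuals
would place among proper ideals. -/
theorem not_isCompleteIntersection [Infinite k] (h : LinkageClass d C)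
    (hbound : degreeBound n d ≤ D) (hdD : ∀ i, d i < D) {K : Ideal (MvPolynomial (Fin n) k)}
    (hK : K ∈ hypersurfaceSections D C) (e : Fin (c + 1) → ℕ) : ¬ IsCompleteIntersection e K := by
  intro hCI
  have hD : 0 < D := lt_of_lt_of_le (by simp [degreeBound]) hbound
  have hmin := h.isMinimalType hbound hdD hK
  have hsort := hCI.comp_perm (Tuple.sort e)
  obtain ⟨L, hL, hLK⟩ := hmin.occurs
  have heq : e ∘ Tuple.sort e = Fin.snoc (α := fun _ => ℕ) d D := funext fun i => le_antisymm
    (hsort.type_le hL hLK (Tuple.monotone_sort e) hmin.monotone i)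
    (hmin.le _ (Tuple.monotone_sort e) ⟨K, hsort, le_rfl⟩ i)
  rw [heq] at hsort
  have := h.closedUnderResiduals hdD K hK K hsort le_rfl
  rw [colon_self_eq_top] at this
  exact h.ne_top_of_mem hD this rfl

theorem height_eq [Infinite k] (h : LinkageClass d C)
    (hbound : degreeBound n d ≤ D) (hdD : ∀ i, d i < D) {K : Ideal (MvPolynomial (Fin n) k)}
    (hK : K ∈ hypersurfaceSections D C) : K.height = (c + 1 : ℕ) := by
  have hD : 0 < D := lt_of_lt_of_le (by simp [degreeBound]) hbound
  obtain ⟨L, hL, hLK⟩ := (h.isMinimalType hbound hdD hK).occurs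
  obtain ⟨I, hI, F, hF, hFI, rfl⟩ := hK
  replace hFI := isSMulRegular_quotient_iff.1 hFI
  obtain ⟨L', hL', hLI'⟩ := (h.minimal I hI).occurs
  exact height_sup_span_singleton (h.homogeneous I hI) (h.ne_top I hI)
    (lt_of_regMod (h.ne_top I hI) hL' hLI' hD hF hFI) (h.regSeq I hI) hD hF hFI hL hLK

/-- Minimal links do not lead out of the class of hypersurface sections. -/
theorem mem_of_directlyMinimallyLinked [Infinite k] (h : LinkageClass d C)
    (hbound : degreeBound n d ≤ D) (hdD : ∀ i, d i < D) {c' : ℕ}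
    {K K' : Ideal (MvPolynomial (Fin n) k)} (hK : K ∈ hypersurfaceSections D C)
    (hlink : DirectlyMinimallyLinked c' K K') : K' ∈ hypersurfaceSections D C := by
  have hD : 0 < D := lt_of_lt_of_le (by simp [degreeBound]) hbound
  obtain ⟨e, L, hmin, hL, hlink⟩ := hlink
  have hc : c' = c + 1 := by
    have h1 := hlink.height_left
    rw [h.height_eq hbound hdD hK] at h1
    exact_mod_cast h1.symm
  subst hc
  have hmin' := h.isMinimalType hbound hdD hK
  have heq : e = Fin.snoc (α := fun _ => ℕ) d D := funext fun i => le_antisymm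
    (hmin.le _ hmin'.monotone hmin'.occurs i) (hmin'.le _ hmin.monotone hmin.occurs i)
  rw [heq] at hL
  rw [← hlink.colon_left]
  exact h.closedUnderResiduals hdD K hK L hL (hlink.colon_right ▸ le_colon L K')

theorem not_isMinimallyHomogeneouslyLicci [Infinite k] (h : LinkageClass d C)
    (hbound : degreeBound n d ≤ D) (hdD : ∀ i, d i < D) {K : Ideal (MvPolynomial (Fin n) k)}
    (hK : K ∈ hypersurfaceSections D C) : ¬ IsMinimallyHomogeneouslyLicci K := by
  rintro ⟨-, c', K', hchain, e, hCI⟩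
  have hmem : ∀ K'', Relation.ReflTransGen (DirectlyMinimallyLinked c') K K'' →
      K'' ∈ hypersurfaceSections D C := by
    intro K'' hchain
    induction hchain with
    | refl => exact hK
    | tail _ hlink ih => exact h.mem_of_directlyMinimallyLinked hbound hdD ih hlink
  have hK' := hmem K' hchain
  have hc : c' = c + 1 := by
    have h1 := hCI.height_eq
    rw [h.height_eq hbound hdD hK'] at h1
    exact_mod_cast h1.symm
  subst hc
  exact h.not_isCompleteIntersection hbound hdD hK' e hCI

end LinkageClass

theorem IsHomogeneouslyLicci.exists_reflTransGen {c : ℕ} {I : Ideal (MvPolynomial (Fin n) k)}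
    (h : IsHomogeneouslyLicci I) (hht : I.height = c) :
    ∃ (K : Ideal (MvPolynomial (Fin n) k)) (e : Fin c → ℕ),
      Relation.ReflTransGen (DirectlyLinked c) I K ∧ IsCompleteIntersection e K := by
  obtain ⟨c', K, hchain, e, hCI⟩ := h
  have hht' : I.height = c' := by
    rcases hchain.cases_head with rfl | ⟨J, ⟨e', L, -, hlink⟩, -⟩
    · exact hCI.height_eq
    · exact hlink.height_left
  obtain rfl : c = c' := by
    rw [hht] at hht'
    exact_mod_cast hht'
  exact ⟨K, e, hchain, hCI⟩

end HypersurfaceSections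

end HomLinkage

/-! ### The main result. -/

theorem proposition3p4 {k : Type*} [Field k] [Infinite k] (r c : ℕ) (d : Fin c → ℕ) :
    ∃ D₀ : ℕ, ∀ D : ℕ, D₀ ≤ D → ∀ C : Set (Ideal (MvPolynomial (Fin (r + 1)) k)),
      (∀ I ∈ C, HomLinkage.IsHomogeneousIdeal I ∧ I ≠ ⊤ ∧ I.height = c) →
      HomLinkage.ClosedUnderResiduals d C →
      (∀ I ∈ C, HomLinkage.IsMinimalType d I) →
      (∀ I ∈ C, HomLinkage.IsHomogeneouslyLicci I →
        HomLinkage.HoldsForGeneralForm D fun F : MvPolynomial (Fin (r + 1)) k =>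
          HomLinkage.IsRegularModulo I F →
            HomLinkage.IsHomogeneouslyLicci (I ⊔ Ideal.span {F}) ∧
            ¬ HomLinkage.IsMinimallyHomogeneouslyLicci (I ⊔ Ideal.span {F})) ∧
      ((∀ I ∈ C, HomLinkage.IsCohenMacaulay (MvPolynomial (Fin (r + 1)) k ⧸ I)) →
        HomLinkage.ClosedUnderResiduals (Fin.snoc (α := fun _ => ℕ) d D)
          (HomLinkage.hypersurfaceSections D C) ∧
        ∀ K ∈ HomLinkage.hypersurfaceSections D C,
          HomLinkage.IsMinimalType (Fin.snoc (α := fun _ => ℕ) d D) K) := by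
  open HomLinkage in
  -- The first summand is the regularity bound for the ideals concerned; the second makes `D` larger
  -- than every `d_i`.
  refine ⟨degreeBound (r + 1) d + (1 + ∑ i, d i), fun D hD₀ C hC hclosed hmin => ⟨?_, ?_⟩⟩
  · intro I hI hlicci
    have hbound : degreeBound (r + 1) d ≤ D := by omega
    have hD : 0 < D := by omega
    have hdD : ∀ i, d i < D := fun i => by
      have := Finset.single_le_sum (f := d) (fun _ _ => Nat.zero_le _) (Finset.mem_univ i)
      omega
    obtain ⟨L, hL, hLI⟩ := (hmin I hI).occurs
    obtain ⟨hhom, hne, hht⟩ := hC I hI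
    obtain ⟨K, e, hchain, hCI⟩ := hlicci.exists_reflTransGen hht
    -- Without a Cohen-Macaulay hypothesis on `C`, the argument runs in the subclass of ideals with
    -- enough linear forms. Linkage preserves it, and it contains the licci ideal `I`.
    have hclass : LinkageClass d {J | J ∈ C ∧ HasLinearRegSeq (r + 1 - c) J} :=
      { homogeneous := fun J hJ => (hC J hJ.1).1
        ne_top := fun J hJ => (hC J hJ.1).2.1
        height := fun J hJ => (hC J hJ.1).2.2
        closed := fun J hJ L hL hLJ =>
          ⟨hclosed J hJ.1 L hL hLJ, (hL.link (hC J hJ.1).1 hLJ hJ.2).2⟩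
        minimal := fun J hJ => hmin J hJ.1
        regSeq := fun J hJ => hJ.2 }
    have hIC : I ∈ {J | J ∈ C ∧ HasLinearRegSeq (r + 1 - c) J} :=
      ⟨hI, hasLinearRegSeq_of_reflTransGen hchain hCI⟩
    by_cases hc : c < r + 1
    · refine (holdsForGeneralForm_reflTransGen hD hc hchain hCI).mono fun F hF hgen hFI => ?_
      exact ⟨⟨c + 1, _, hgen.1, _, hgen.2⟩,
        hclass.not_isMinimallyHomogeneouslyLicci hbound hdD ⟨I, hIC, F, hF, hFI, rfl⟩⟩
    -- In the remaining case no form of degree `D` is regular modulo `I`, so the claim is vacuous.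
    · exact holdsForGeneralForm_of_forall fun F hF hFI =>
        absurd (lt_of_regMod hne hL hLI hD hF (isSMulRegular_quotient_iff.1 hFI)) hc
  · intro hCM
    have hbound : degreeBound (r + 1) d ≤ D := by omega
    have hdD : ∀ i, d i < D := fun i => by
      have := Finset.single_le_sum (f := d) (fun _ _ => Nat.zero_le _) (Finset.mem_univ i)
      omega
    have hclass : LinkageClass d C :=
      { homogeneous := fun J hJ => (hC J hJ).1
        ne_top := fun J hJ => (hC J hJ).2.1
        height := fun J hJ => (hC J hJ).2.2
        closed := hclosed
        minimal := hmin
        regSeq := fun J hJ => by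
          obtain ⟨L, hL, hLJ⟩ := (hmin J hJ).occurs
          exact (hCM J hJ).hasLinearRegSeq (hC J hJ).1 (hC J hJ).2.1 (hC J hJ).2.2 hL hLJ }
    exact ⟨hclass.closedUnderResiduals hdD,
      fun K hK => hclass.isMinimalType hbound hdD hK⟩
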